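/- Let $0<\alpha,\beta,\gamma<1$ be constants. The stochastic Kronecker graph $K(n,P)$ is the random simple graph whose vertices are the $2^n$ binary strings of length $n$, in which every pair $\{u,v\}$ of distinct vertices is an edge, independently of all other pairs, with probability $p_{u,v}=\prod_{k=1}^n P_{u_k,v_k}$, where $P_{1,1}=\alpha$, $P_{0,0}=\gamma$ and $P_{0,1}=P_{1,0}=\beta$. Let $Z_d$ be the number of vertices of degree $d$ in $K(n,P)$. An event holds a.a.s. if its probability tends to $1$ as $n\to\infty$. (1) A.a.s. $K(n,P)$ does not have a power-law degree distribution, in the following uniform sense. For all constants $c_0>0$, $T>0$, $0<\varepsilon<1$ and every integer $d_0\ge 1$ there is an integer $D\ge d_0$, not depending on $n$, such that a.a.s. there are no real numbers $c\ge c_0$ and $0<\tau\le T$ with $$\left|Z_d-c\,d^{-\tau}2^n\right|\le \varepsilon\, c\,d^{-\tau}2^n\qquad\text{for all integers } d_0\le d\le D.$$ (2) For every fixed integer $d\ge 0$, as $n\to\infty$, $$\mathbb E(Z_d)=\Theta\left(\left((\alpha+\beta)^d+(\beta+\gamma)^d\right)^n\right)\qquad\text{or}\qquad \mathbb E(Z_d)=o(2^n).$$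 (3) For every fixed integer $d\ge 1$, $\mathbb E(Z_d)=\Theta(2^n)$ if and only if $\alpha+\beta=\beta+\gamma=1$. (4) If $\alpha+\beta=\beta+\gamma=1$, then for every fixed integer $d\ge 0$ we have $\mathbb E(Z_d)=(1+o(1))\,2^n/(e\,d!)$ and a.a.s. $Z_d=(1+o(1))\,2^n/(e\,d!)$, that is, for every $\varepsilon>0$, a.a.s. $\left|Z_d-2^n/(e\,d!)\right|\le\varepsilon\,2^n/(e\,d!)$. -/

import Mathlib

open MeasureTheory ProbabilityTheory Filter Topology Asymptotics unitInterval

namespace Kronecker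

/-- Vertices: binary strings of length `n`. -/
abbrev Vertex (n : ℕ) : Type := Fin n → Fin 2

/-- The symmetric probability matrix `P`, indexed by binary digits: the entry is `α` for the digit
pair `(1, 1)`, `γ` for `(0, 0)` and `β` for `(0, 1)` and `(1, 0)`. -/
def probMatrix (α β γ : I) : Matrix (Fin 2) (Fin 2) I :=
  !![γ, β; β, α]

theorem probMatrix_comm (α β γ : I) (a b : Fin 2) :
    probMatrix α β γ a b = probMatrix α β γ b a := by
  fin_cases a <;> fin_cases b <;> rfl

/-- The edge probability `p_{u,v} = ∏ₖ P (u k) (v k)` of the unordered pair `{u, v}`. -/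
noncomputable def edgeProb (α β γ : I) (n : ℕ) : Sym2 (Vertex n) → I :=
  Sym2.lift ⟨fun u v => ∏ k, probMatrix α β γ (u k) (v k), fun u v =>
    Finset.prod_congr rfl fun k _ => probMatrix_comm α β γ (u k) (v k)⟩

/-- Independent coins, one for every unordered pair `e`, equal to `true` with probability
`edgeProb α β γ n e`. -/
noncomputable def coinMeasure (α β γ : I) (n : ℕ) : Measure (Sym2 (Vertex n) → Bool) :=
  Measure.pi fun e => bernoulliMeasure true false (edgeProb α β γ n e)

/-- The simple graph whose edges are the pairs of distinct vertices whose coin shows `true`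
(`SimpleGraph.fromEdgeSet` discards the diagonal pairs). -/
def coinGraph {n : ℕ} (ω : Sym2 (Vertex n) → Bool) : SimpleGraph (Vertex n) :=
  SimpleGraph.fromEdgeSet {e | ω e = true}

theorem measurable_coinGraph (n : ℕ) :
    Measurable (coinGraph : (Sym2 (Vertex n) → Bool) → SimpleGraph (Vertex n)) :=
  Measurable.of_discrete

/-- The stochastic Kronecker graph `K(n, P)`, as a law on simple graphs with vertex set
`Vertex n`. -/
noncomputable def kroneckerGraph (α β γ : I) (n : ℕ) : Measure (SimpleGraph (Vertex n)) :=
  (coinMeasure α β γ n).map coinGraph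

instance (α β γ : I) (n : ℕ) : IsProbabilityMeasure (coinMeasure α β γ n) := by
  unfold coinMeasure; infer_instance

instance (α β γ : I) (n : ℕ) : IsProbabilityMeasure (kroneckerGraph α β γ n) :=
  Measure.isProbabilityMeasure_map (measurable_coinGraph n).aemeasurable

/-- The number of vertices of degree `d` in a finite graph. -/
noncomputable def numDegree {V : Type} (G : SimpleGraph V) (d : ℕ) : ℕ :=
  {v : V | (G.neighborSet v).ncard = d}.ncard

/-- The expected number of vertices of degree `d` in `K(n, P)`. -/
noncomputable def expNumDegree (α β γ : I) (d n : ℕ) : ℝ :=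
  ∫ G, (numDegree G d : ℝ) ∂(kroneckerGraph α β γ n)

/-- `K(n, P)` has the property `Q` asymptotically almost surely. -/
def AAS (α β γ : I) (Q : ∀ n, SimpleGraph (Vertex n) → Prop) : Prop :=
  Tendsto (fun n => (kroneckerGraph α β γ n).real {G | Q n G}) atTop (𝓝 1)

/-- In the finite graph `G`, for every degree `d` with `d₀ ≤ d ≤ D`, the number of vertices of
degree `d` agrees with `c * d ^ (-τ) * |V|` up to a factor between `1 - ε` and `1 + ε`. -/
def IsPowerLaw {V : Type} (G : SimpleGraph V) (c τ ε : ℝ) (d₀ D : ℕ) : Prop :=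
  ∀ d : ℕ, d₀ ≤ d → d ≤ D →
    |(numDegree G d : ℝ) - c * (d : ℝ) ^ (-τ) * (Nat.card V : ℝ)| ≤
      ε * (c * (d : ℝ) ^ (-τ) * (Nat.card V : ℝ))

end Kronecker

/-!
The degree of a vertex `u` is a sum of independent indicators with mean close to
`degreeMean u = ∏ k, rowSum (u k)`, where the row sums `α + β` and `β + γ` of the probability
matrix belong to the digits `1` and `0`.

If both row sums are `1`, all these means are `1`. By Le Cam's inequality every degree is within
`O(q ^ n)` of the Poisson law with parameter `1` for some `q < 1`, so a vertex has degree `d` with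
probability about `1 / (e d!)`. Two degrees share only the coin of one pair, hence the variance of
`Z_d` is `O(2 ^ n)` and Chebyshev's inequality gives concentration. Since `1 / (e d!)` decays
faster than any power of `d`, no power law can hold up to a large degree.

Otherwise `log (degreeMean u)` is a nontrivial sum over the digits of `u`. By the anticoncentration
of the binomial distribution all but `o(2 ^ n)` strings have a mean outside any given compact
subset of `(0, ∞)`, where the probability of a fixed degree `d ≥ 1` is small, so
`E(Z_d) = o(2 ^ n)`, and Markov's inequality excludes a power law already in the degree `d₀`.

For `d = 0` the comparison is between `(α + β) * (β + γ)` and `1`: the means at complementary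
strings multiply to the `n`-th power of this product. If it is at most `1`, half of the strings
have mean at most `1` and are isolated with probability bounded below; if it exceeds `1`, a
fractional moment of `1 / degreeMean u` shows `E(Z_0) = o(2 ^ n)`.
-/

namespace Kronecker

/-! ### Total variation distance and the Poisson law -/

section Poisson

open scoped NNReal ProbabilityTheory

theorem abs_real_conv_sub_real_conv_le {M : Type*} [AddMonoid M] [MeasurableSpace M]
    [MeasurableAdd₂ M] {μ₁ μ₂ ν : Measure M} [IsProbabilityMeasure μ₁] [IsProbabilityMeasure μ₂]
    [IsProbabilityMeasure ν] {ε : ℝ}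
    (h : ∀ S, MeasurableSet S → |μ₁.real S - μ₂.real S| ≤ ε) {S : Set M} (hS : MeasurableSet S) :
    |(μ₁ ∗ ν).real S - (μ₂ ∗ ν).real S| ≤ ε := by
  have key (μ : Measure M) [IsProbabilityMeasure μ] :
      Integrable (fun y => μ.real ((· + y) ⁻¹' S)) ν ∧
        (μ ∗ ν).real S = ∫ y, μ.real ((· + y) ⁻¹' S) ∂ν := by
    have hS' : MeasurableSet ((fun z : M × M => z.1 + z.2) ⁻¹' S) := measurable_add hS
    have hm := (measurable_measure_prodMk_right (μ := μ) hS').ennreal_toReal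
    refine ⟨.of_bound hm.aestronglyMeasurable 1 (.of_forall fun y => ?_), ?_⟩
    · exact (Real.norm_of_nonneg measureReal_nonneg).trans_le measureReal_le_one
    · rw [Measure.conv, map_measureReal_apply measurable_add hS, measureReal_def,
        Measure.prod_apply_symm hS', ← integral_toReal]
      · rfl
      · exact (measurable_measure_prodMk_right hS').aemeasurable
      · exact .of_forall fun y => measure_lt_top _ _
  obtain ⟨hi₁, h₁⟩ := key μ₁
  obtain ⟨hi₂, h₂⟩ := key μ₂
  rw [h₁, h₂, ← integral_sub hi₁ hi₂]
  simpa using norm_integral_le_of_norm_le_const (μ := ν) (C := ε)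
    (f := fun y => μ₁.real ((· + y) ⁻¹' S) - μ₂.real ((· + y) ⁻¹' S))
    (.of_forall fun y => h _ (measurable_add_const y hS))

theorem abs_measureReal_sub_le_of_forall_sub_le {X : Type*} [MeasurableSpace X] {μ ν : Measure X}
    [IsProbabilityMeasure μ] [IsProbabilityMeasure ν] {ε : ℝ}
    (h : ∀ S, MeasurableSet S → μ.real S - ν.real S ≤ ε) {S : Set X} (hS : MeasurableSet S) :
    |μ.real S - ν.real S| ≤ ε := by
  have hc := h Sᶜ hS.compl
  rw [probReal_compl_eq_one_sub hS, probReal_compl_eq_one_sub hS] at hc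
  exact abs_le.2 ⟨by linarith, h S hS⟩

theorem poissonMeasure_real_singleton_le {r : ℝ≥0} {S : Set ℕ} {k : ℕ} (hk : k ∈ S) :
    Real.exp (-r) * r ^ k / k.factorial ≤ Po(r).real S := by
  rw [← poissonMeasure_real_singleton]
  exact measureReal_mono (Set.singleton_subset_iff.2 hk)

theorem exp_neg_mul_one_add_le_poissonMeasure_real {r : ℝ≥0} {S : Set ℕ} (h₀ : 0 ∈ S)
    (h₁ : 1 ∈ S) : Real.exp (-r) * (1 + r) ≤ Po(r).real S :=
  calc Real.exp (-r) * (1 + r) = ∑ k ∈ {0, 1}, Po(r).real {k} := by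
        simp [poissonMeasure_real_singleton, mul_add]
    _ = Po(r).real ({0, 1} : Finset ℕ) := sum_measureReal_singleton _
    _ ≤ Po(r).real S := measureReal_mono (by simp [Set.insert_subset_iff, h₀, h₁])

theorem abs_bernoulliMeasure_real_sub_poissonMeasure_real_le (p : I) (S : Set ℕ) :
    |Ber(1, 0, p).real S - Po(unitInterval.toNNReal p).real S| ≤ (p : ℝ) ^ 2 := by
  classical
  refine abs_measureReal_sub_le_of_forall_sub_le (fun S _ => ?_) .of_discrete
  let Q := Po(unitInterval.toNNReal p).real S
  have hp : 0 ≤ (p : ℝ) := p.2.1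
  have hexp : 1 - (p : ℝ) ≤ Real.exp (-p) := Real.one_sub_le_exp_neg p
  have hQ : 0 ≤ Q := measureReal_nonneg
  have hQ₀ : 0 ∈ S → Real.exp (-p) ≤ Q := fun h => by
    simpa using poissonMeasure_real_singleton_le (r := unitInterval.toNNReal p) h
  have hQ₁ : 1 ∈ S → Real.exp (-p) * p ≤ Q := fun h => by
    simpa using poissonMeasure_real_singleton_le (r := unitInterval.toNNReal p) h
  have hQ₂ : 0 ∈ S → 1 ∈ S → Real.exp (-p) * (1 + p) ≤ Q :=
    exp_neg_mul_one_add_le_poissonMeasure_real (r := unitInterval.toNNReal p)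
  change _ - Q ≤ _
  rw [bernoulliMeasure_real_apply p .of_discrete, coe_toNNReal, coe_toNNReal, coe_symm_eq]
  split_ifs with h₁ h₀ h₀
  · nlinarith [hQ₂ h₀ h₁]
  · nlinarith [hQ₁ h₁]
  · nlinarith [hQ₀ h₀]
  · nlinarith

theorem abs_poissonMeasure_real_sub_dirac_zero_real_le (r : ℝ≥0) (S : Set ℕ) :
    |Po(r).real S - (Measure.dirac 0).real S| ≤ r := by
  rw [abs_sub_comm]
  refine abs_measureReal_sub_le_of_forall_sub_le (fun S _ => ?_) .of_discrete
  by_cases h₀ : 0 ∈ S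
  · have h : Real.exp (-r) ≤ Po(r).real S := by simpa using poissonMeasure_real_singleton_le h₀
    linarith [Real.one_sub_le_exp_neg r, measureReal_le_one (μ := Measure.dirac 0) (s := S)]
  · rw [measureReal_def, Measure.dirac_apply' _ .of_discrete, Set.indicator_of_notMem h₀,
      ENNReal.toReal_zero]
    linarith [r.2, measureReal_nonneg (μ := Po(r)) (s := S)]

theorem abs_poissonMeasure_add_real_sub_poissonMeasure_real_le (r s : ℝ≥0) (S : Set ℕ) :
    |Po(r + s).real S - Po(r).real S| ≤ s := by
  have h := abs_real_conv_sub_real_conv_le (ν := Po(r))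
    (fun S _ => abs_poissonMeasure_real_sub_dirac_zero_real_le s S) (S := S) .of_discrete
  rwa [poissonMeasure_conv_poissonMeasure, Measure.dirac_zero_conv, add_comm] at h

end Poisson

/-! ### Counts of independent events -/

section EventCount

open scoped NNReal ProbabilityTheory

variable {Ω ι : Type*}

/-- The number of those events `A i`, `i ∈ s`, which occur at `ω`. Vertex degrees and the numbers
`numDegree` are treated as counts of this form. -/
noncomputable def eventCount (A : ι → Set Ω) (s : Finset ι) (ω : Ω) : ℕ :=
  ∑ i ∈ s, (A i).indicator (fun _ => 1) ω

theorem eventCount_eq_card (A : ι → Set Ω) (s : Finset ι) (ω : Ω) [DecidablePred (ω ∈ A ·)] :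
    eventCount A s ω = {i ∈ s | ω ∈ A i}.card := by
  rw [Finset.card_filter]
  exact Finset.sum_congr rfl fun i _ => Set.indicator_apply _ _ _

theorem eventCount_eq_zero_iff {A : ι → Set Ω} {s : Finset ι} {ω : Ω} :
    eventCount A s ω = 0 ↔ ∀ i ∈ s, ω ∉ A i := by
  simp [eventCount, Finset.sum_eq_zero_iff]

theorem eventCount_eq_sum (A : ι → Set Ω) (s : Finset ι) :
    eventCount A s = ∑ i ∈ s, (A i).indicator fun _ => 1 := by
  ext ω
  rw [eventCount, Finset.sum_apply]

theorem eventCount_empty (A : ι → Set Ω) : eventCount A ∅ = fun _ => 0 := rfl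

theorem eventCount_insert [DecidableEq ι] (A : ι → Set Ω) {s : Finset ι} {i : ι} (hi : i ∉ s) :
    eventCount A (insert i s) = (A i).indicator (fun _ => 1) + eventCount A s := by
  rw [eventCount_eq_sum, eventCount_eq_sum, Finset.sum_insert hi]

theorem cast_eventCount (A : ι → Set Ω) (s : Finset ι) (ω : Ω) :
    (eventCount A s ω : ℝ) = ∑ i ∈ s, (A i).indicator (fun _ => 1) ω := by
  rw [eventCount, Nat.cast_sum]
  exact Finset.sum_congr rfl fun i _ => by by_cases hω : ω ∈ A i <;> simp [hω]

theorem eventCount_sdiff_eq_of_forall_notMem [DecidableEq ι] {s t : Finset ι} {ω : Ω}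
    (hω : ∀ i ∈ s ∩ t, ω ∉ A i) : eventCount A (s \ t) ω = eventCount A s ω := by
  rw [eventCount, eventCount, ← Finset.sum_inter_add_sum_sdiff s t,
    Finset.sum_eq_zero fun i hi => Set.indicator_of_notMem (hω i hi) _, zero_add]

variable [MeasurableSpace Ω] {μ : Measure Ω} {A : ι → Set Ω}

theorem measurable_eventCount (hA : ∀ i, MeasurableSet (A i)) (s : Finset ι) :
    Measurable (eventCount A s) :=
  Finset.measurable_fun_sum s fun i _ => measurable_const.indicator (hA i)

theorem measurableSet_eventCount_eq (hA : ∀ i, MeasurableSet (A i)) (s : Finset ι) (d : ℕ) :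
    MeasurableSet {ω | eventCount A s ω = d} :=
  measurable_eventCount hA s (measurableSet_singleton d)

theorem map_indicator_one_eq_bernoulliMeasure [IsProbabilityMeasure μ] {B : Set Ω}
    (hB : MeasurableSet B) {p : I} (hp : p = μ.real B) :
    μ.map (B.indicator fun _ => (1 : ℕ)) = Ber(1, 0, p) := by
  classical
  have hB' : (unitInterval.toNNReal p : ENNReal) = μ B := by
    rw [ENNReal.coe_nnreal_eq, coe_toNNReal, hp, ofReal_measureReal]
  have hBc : (unitInterval.toNNReal (σ p) : ENNReal) = μ Bᶜ := by
    rw [ENNReal.coe_nnreal_eq, coe_toNNReal, coe_symm_eq, hp, ← probReal_compl_eq_one_sub hB,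
      ofReal_measureReal]
  ext S hS
  rw [Measure.map_apply (measurable_const.indicator hB) hS, bernoulliMeasure_apply _ hS,
    Set.indicator_const_preimage_eq_union, hB', hBc]
  by_cases h₁ : 1 ∈ S <;> by_cases h₀ : 0 ∈ S <;> simp [h₁, h₀]

theorem indepFun_indicator_eventCount (h : iIndepSet A μ) (hA : ∀ i, MeasurableSet (A i))
    {s : Finset ι} {i : ι} (hi : i ∉ s) :
    IndepFun ((A i).indicator fun _ => (1 : ℕ)) (eventCount A s) μ := by
  rw [eventCount_eq_sum]
  exact (h.iIndepFun_indicator.indepFun_finsetSum_of_notMem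
    (fun j => measurable_const.indicator (hA j)) hi).symm

theorem abs_measureReal_eventCount_sub_poissonMeasure_real_le (h : iIndepSet A μ)
    (hA : ∀ i, MeasurableSet (A i)) (s : Finset ι) (S : Set ℕ) :
    |μ.real (eventCount A s ⁻¹' S) - Po(∑ i ∈ s, (μ (A i)).toNNReal).real S| ≤
      ∑ i ∈ s, μ.real (A i) ^ 2 := by
  classical
  have := h.isProbabilityMeasure
  suffices hmap : ∀ S, MeasurableSet S → |(μ.map (eventCount A s)).real S -
      Po(∑ i ∈ s, (μ (A i)).toNNReal).real S| ≤ ∑ i ∈ s, μ.real (A i) ^ 2 by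
    simpa only [map_measureReal_apply (measurable_eventCount hA s) (.of_discrete (s := S))]
      using hmap S .of_discrete
  induction s using Finset.induction_on with
  | empty =>
    intro S _
    have hmap : μ.map (eventCount A ∅) = Measure.dirac 0 := by
      rw [eventCount_empty, Measure.map_const, measure_univ, one_smul]
    rw [hmap, Finset.sum_empty, Finset.sum_empty, abs_sub_comm]
    exact abs_poissonMeasure_real_sub_dirac_zero_real_le 0 S
  | insert i s hi ih =>
    intro S hS
    have hlaw : μ.map (eventCount A (insert i s)) =
        μ.map ((A i).indicator fun _ => 1) ∗ μ.map (eventCount A s) := by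
      rw [eventCount_insert A hi]
      exact (indepFun_indicator_eventCount h hA hi).map_add_eq_map_conv_map
        (measurable_const.indicator (hA i)) (measurable_eventCount hA s)
    have := Measure.isProbabilityMeasure_map (μ := μ) (measurable_eventCount hA s).aemeasurable
    let p : I := ⟨μ.real (A i), measureReal_nonneg, measureReal_le_one⟩
    have hp : (μ (A i)).toNNReal = unitInterval.toNNReal p := rfl
    rw [Finset.sum_insert hi, Finset.sum_insert hi, hp, hlaw,
      map_indicator_one_eq_bernoulliMeasure (hA i) (p := p) rfl,
      ← poissonMeasure_conv_poissonMeasure]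
    refine (abs_sub_le _ ((Po(unitInterval.toNNReal p) ∗ μ.map (eventCount A s)).real S) _).trans
      (add_le_add ?_ ?_)
    · exact abs_real_conv_sub_real_conv_le
        (fun S _ => abs_bernoulliMeasure_real_sub_poissonMeasure_real_le p S) hS
    · rw [Measure.conv_comm, Measure.conv_comm Po(unitInterval.toNNReal p)]
      exact abs_real_conv_sub_real_conv_le ih hS

theorem measureReal_eventCount_eq_le_sum [IsFiniteMeasure μ] (s : Finset ι) {d : ℕ} (hd : d ≠ 0) :
    μ.real {ω | eventCount A s ω = d} ≤ ∑ i ∈ s, μ.real (A i) := by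
  refine le_trans ?_ (measureReal_biUnion_finset_le s A)
  refine measureReal_mono (fun ω hω => ?_) (measure_ne_top _ _)
  by_contra hs
  have h0 : eventCount A s ω = 0 := eventCount_eq_zero_iff.2 (by simpa using hs)
  exact hd (hω.symm.trans h0)

theorem integral_pow_eventCount (h : iIndepSet A μ) (hA : ∀ i, MeasurableSet (A i))
    (s : Finset ι) (x : ℝ) :
    ∫ ω, x ^ eventCount A s ω ∂μ = ∏ i ∈ s, (1 - (1 - x) * μ.real (A i)) := by
  classical
  have := h.isProbabilityMeasure
  induction s using Finset.induction_on with
  | empty => simp [eventCount_empty]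
  | insert i s hi ih =>
    have hpow : Measurable fun k : ℕ => x ^ k := .of_discrete
    have hone : (fun ω => x ^ (A i).indicator (fun _ => 1) ω) =
        fun ω => 1 - (A i).indicator (fun _ => 1 - x) ω := by
      ext ω
      by_cases hω : ω ∈ A i <;> simp [hω]
    have hint : ∫ ω, x ^ (A i).indicator (fun _ => 1) ω ∂μ = 1 - (1 - x) * μ.real (A i) := by
      rw [hone, integral_sub (integrable_const _) ((integrable_const _).indicator (hA i)),
        integral_indicator_const _ (hA i)]
      simp [mul_comm]
    have hindep := (indepFun_indicator_eventCount h hA hi).comp hpow hpow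
    simp only [eventCount_insert A hi, Pi.add_apply, pow_add]
    rw [Finset.prod_insert hi, ← ih, ← hint]
    exact hindep.integral_fun_mul_eq_mul_integral
      (hpow.comp (measurable_const.indicator (hA i))).aestronglyMeasurable
      (hpow.comp (measurable_eventCount hA s)).aestronglyMeasurable

theorem measureReal_eventCount_eq_zero (h : iIndepSet A μ) (hA : ∀ i, MeasurableSet (A i))
    (s : Finset ι) :
    μ.real {ω | eventCount A s ω = 0} = ∏ i ∈ s, (1 - μ.real (A i)) := by
  have hzero : (fun ω => (0 : ℝ) ^ eventCount A s ω) =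
      {ω | eventCount A s ω = 0}.indicator 1 := by
    ext ω
    simp [Set.indicator_apply, zero_pow_eq]
  have hpow := integral_pow_eventCount h hA s 0
  rw [hzero, integral_indicator_one (measurableSet_eventCount_eq hA s 0)] at hpow
  simpa only [sub_zero, one_mul] using hpow

theorem measureReal_eventCount_eq_le_two_pow_mul_exp (h : iIndepSet A μ)
    (hA : ∀ i, MeasurableSet (A i)) (s : Finset ι) (d : ℕ) :
    μ.real {ω | eventCount A s ω = d} ≤ 2 ^ d * Real.exp (-(∑ i ∈ s, μ.real (A i)) / 2) := by
  have := h.isProbabilityMeasure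
  have hmarkov : (1 / 2) ^ d * μ.real {ω | eventCount A s ω = d} ≤
      ∫ ω, (1 / 2 : ℝ) ^ eventCount A s ω ∂μ := by
    have hint : Integrable (fun ω => (1 / 2 : ℝ) ^ eventCount A s ω) μ :=
      .of_bound ((Measurable.of_discrete (f := fun k : ℕ => (1 / 2 : ℝ) ^ k)).comp
        (measurable_eventCount hA s)).aestronglyMeasurable 1
        (.of_forall fun ω => by simpa using inv_le_one_of_one_le₀ (one_le_pow₀ one_le_two))
    refine le_trans ?_ (mul_meas_ge_le_integral_of_nonneg
      (.of_forall fun ω => by positivity) hint ((1 / 2) ^ d))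
    refine mul_le_mul_of_nonneg_left (measureReal_mono fun ω hω => ?_) (by positivity)
    exact (congrArg ((1 / 2 : ℝ) ^ ·) hω).ge
  have hprod : ∏ i ∈ s, (1 - (1 - 1 / 2) * μ.real (A i)) ≤
      Real.exp (-(∑ i ∈ s, μ.real (A i)) / 2) := by
    rw [← Finset.sum_neg_distrib, Finset.sum_div, Real.exp_sum]
    refine Finset.prod_le_prod (fun i _ => ?_) fun i _ => ?_
    · linarith [measureReal_le_one (μ := μ) (s := A i)]
    · exact (Real.one_sub_le_exp_neg _).trans_eq (by ring_nf)
  rw [integral_pow_eventCount h hA] at hmarkov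
  calc μ.real {ω | eventCount A s ω = d}
      = 2 ^ d * ((1 / 2) ^ d * μ.real {ω | eventCount A s ω = d}) := by
        rw [← mul_assoc, ← mul_pow]
        norm_num
    _ ≤ 2 ^ d * Real.exp (-(∑ i ∈ s, μ.real (A i)) / 2) := by
        gcongr
        exact hmarkov.trans hprod

theorem exp_neg_sum_div_le_measureReal_eventCount_eq_zero (h : iIndepSet A μ)
    (hA : ∀ i, MeasurableSet (A i)) {s : Finset ι} {q : ℝ} (hq : q < 1)
    (hs : ∀ i ∈ s, μ.real (A i) ≤ q) :
    Real.exp (-(∑ i ∈ s, μ.real (A i)) / (1 - q)) ≤ μ.real {ω | eventCount A s ω = 0} := by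
  rw [measureReal_eventCount_eq_zero h hA, ← Finset.sum_neg_distrib, Finset.sum_div, Real.exp_sum]
  refine Finset.prod_le_prod (fun i _ => (Real.exp_pos _).le) fun i hi => ?_
  set p := μ.real (A i)
  have hp : p ≤ q := hs i hi
  have : 0 ≤ p := measureReal_nonneg
  rw [← Real.le_log_iff_exp_le (by linarith)]
  refine le_trans ?_ (Real.one_sub_inv_le_log_of_pos (by linarith))
  have hfrac : 1 - (1 - p)⁻¹ = -p / (1 - p) := by
    have : 1 - p ≠ 0 := by linarith
    field_simp
    ring
  rw [hfrac, neg_div, neg_div]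
  gcongr

theorem indepFun_eventCount_of_disjoint (h : iIndepSet A μ) (hA : ∀ i, MeasurableSet (A i))
    {s t : Finset ι} (hst : Disjoint s t) : IndepFun (eventCount A s) (eventCount A t) μ := by
  have hsum (s : Finset ι) : eventCount A s =
      (fun f => ∑ i : s, f i) ∘ fun ω (i : s) => (A i).indicator (fun _ => 1) ω := by
    ext ω
    exact (Finset.sum_coe_sort s _).symm
  rw [hsum s, hsum t]
  exact (h.iIndepFun_indicator.indepFun_finset s t hst fun i =>
    measurable_const.indicator (hA i)).comp .of_discrete .of_discrete

/- Off the event that some `A i` with `i ∈ s ∩ t` occurs, the two counts agree with those over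
the disjoint index sets `s \ t` and `t \ s`. -/
theorem measureReal_eventCount_inter_le [DecidableEq ι] (h : iIndepSet A μ)
    (hA : ∀ i, MeasurableSet (A i)) (s t : Finset ι) (a b : ℕ) :
    μ.real ({ω | eventCount A s ω = a} ∩ {ω | eventCount A t ω = b}) ≤
      μ.real {ω | eventCount A s ω = a} * μ.real {ω | eventCount A t ω = b} +
        3 * ∑ i ∈ s ∩ t, μ.real (A i) := by
  have := h.isProbabilityMeasure
  let E := ⋃ i ∈ s ∩ t, A i
  let X := {ω | eventCount A s ω = a}
  let Y := {ω | eventCount A t ω = b}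
  let X' := {ω | eventCount A (s \ t) ω = a}
  let Y' := {ω | eventCount A (t \ s) ω = b}
  have hE : μ.real E ≤ ∑ i ∈ s ∩ t, μ.real (A i) := measureReal_biUnion_finset_le _ _
  have hunion {X X' : Set Ω} (hX : ∀ ω ∈ X, ω ∉ E → ω ∈ X') : μ.real X ≤ μ.real X' + μ.real E :=
    (measureReal_mono fun ω hω => or_iff_not_imp_right.2 (hX ω hω)).trans (measureReal_union_le _ _)
  have hs {ω} (hω : ω ∉ E) : eventCount A (s \ t) ω = eventCount A s ω :=
    eventCount_sdiff_eq_of_forall_notMem fun i hi hi' => hω (Set.mem_biUnion hi hi')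
  have ht {ω} (hω : ω ∉ E) : eventCount A (t \ s) ω = eventCount A t ω :=
    eventCount_sdiff_eq_of_forall_notMem fun i hi hi' =>
      hω (Set.mem_biUnion (Finset.inter_comm t s ▸ hi) hi')
  have hXX' : μ.real X' ≤ μ.real X + μ.real E := hunion fun ω hω hE => (hs hE).symm.trans hω
  have hYY' : μ.real Y' ≤ μ.real Y + μ.real E := hunion fun ω hω hE => (ht hE).symm.trans hω
  have hXY : μ.real (X ∩ Y) ≤ μ.real (X' ∩ Y') + μ.real E :=
    hunion fun ω hω hE => ⟨(hs hE).trans hω.1, (ht hE).trans hω.2⟩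
  have hindep : μ.real (X' ∩ Y') = μ.real X' * μ.real Y' :=
    congrArg ENNReal.toReal ((indepFun_eventCount_of_disjoint h hA
      disjoint_sdiff_sdiff).measure_inter_preimage_eq_mul {a} {b} .of_discrete .of_discrete)
      |>.trans ENNReal.toReal_mul
  have hX₁ : μ.real X ≤ 1 := measureReal_le_one
  have hY₁ : μ.real Y' ≤ 1 := measureReal_le_one
  have hX₀ : 0 ≤ μ.real X := measureReal_nonneg
  have hY₀ : 0 ≤ μ.real Y' := measureReal_nonneg
  have hE₀ : 0 ≤ μ.real E := measureReal_nonneg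
  rw [hindep] at hXY
  nlinarith [mul_le_mul_of_nonneg_right hXX' hY₀, mul_le_mul_of_nonneg_left hYY' hX₀]

theorem integral_eventCount [IsFiniteMeasure μ] (hA : ∀ i, MeasurableSet (A i)) (s : Finset ι) :
    ∫ ω, (eventCount A s ω : ℝ) ∂μ = ∑ i ∈ s, μ.real (A i) := by
  simp only [cast_eventCount]
  rw [integral_finsetSum _ fun i _ => (integrable_const _).indicator (hA i)]
  exact Finset.sum_congr rfl fun i _ => integral_indicator_one (hA i)

theorem variance_eventCount [IsProbabilityMeasure μ] (hA : ∀ i, MeasurableSet (A i))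
    (s : Finset ι) :
    Var[fun ω => (eventCount A s ω : ℝ); μ] =
      ∑ i ∈ s, ∑ j ∈ s, (μ.real (A i ∩ A j) - μ.real (A i) * μ.real (A j)) := by
  have hL (i : ι) : MemLp ((A i).indicator fun _ => (1 : ℝ)) 2 μ :=
    (memLp_const 1).indicator (hA i)
  simp only [cast_eventCount]
  rw [variance_fun_sum' fun i _ => hL i]
  refine Finset.sum_congr rfl fun i _ => Finset.sum_congr rfl fun j _ => ?_
  have hmul : (A i).indicator (fun _ => (1 : ℝ)) * (A j).indicator (fun _ => 1) =
      (A i ∩ A j).indicator 1 := by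
    rw [Set.inter_indicator_one]
    rfl
  change cov[(A i).indicator fun _ => (1 : ℝ), (A j).indicator fun _ => 1; μ] = _
  rw [covariance_eq_sub (hL i) (hL j), hmul, integral_indicator_one ((hA i).inter (hA j))]
  congr 1
  exact congrArg₂ _ (integral_indicator_one (hA i)) (integral_indicator_one (hA j))

end EventCount

/-! ### Degrees as counts of edges -/

section
variable {n : ℕ}

/-- The event that the pair `e` is an edge of the graph; it is empty for diagonal pairs. -/
def edgeEvent {V : Type*} (e : Sym2 V) : Set (SimpleGraph V) :=
  {G | e ∈ G.edgeSet}

theorem measurableSet_edgeEvent {V : Type*} (e : Sym2 V) : MeasurableSet (edgeEvent e) :=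
  measurableSet_setOfPred.2 ((measurable_set_mem e).comp SimpleGraph.measurable_edgeSet)

theorem edgeEvent_mk_self {V : Type*} (u : V) : edgeEvent s(u, u) = ∅ := by
  simp [edgeEvent]

/-- The pairs containing the vertex `u`, the diagonal one included. -/
def star {V : Type*} [Fintype V] (u : V) : Finset (Sym2 V) :=
  Finset.univ.map (Sym2.mkEmbedding u)

theorem mem_star {V : Type*} [Fintype V] {u : V} {e : Sym2 V} : e ∈ star u ↔ u ∈ e := by
  simp [star, Sym2.mem_iff_exists, eq_comm]

theorem sum_star {V M : Type*} [Fintype V] [AddCommMonoid M] (u : V) (f : Sym2 V → M) :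
    ∑ e ∈ star u, f e = ∑ v, f s(u, v) := by
  simp [star]

theorem star_inter_star {V : Type*} [Fintype V] [DecidableEq V] {u v : V} (h : u ≠ v) :
    star u ∩ star v = {s(u, v)} := by
  ext e
  rw [Finset.mem_inter, mem_star, mem_star, Finset.mem_singleton, Sym2.mem_and_mem_iff h]

theorem ncard_neighborSet_eq_eventCount {V : Type*} [Fintype V] (G : SimpleGraph V) (u : V) :
    (G.neighborSet u).ncard = eventCount edgeEvent (star u) G := by
  classical
  rw [eventCount, sum_star]
  simp only [Set.indicator_apply, ← Finset.card_filter, ← Set.ncard_coe_finset]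
  congr 1
  ext v
  simp [edgeEvent]

/-- The event that the vertex `u` has degree `d`. -/
def degreeEvent {V : Type*} (d : ℕ) (u : V) : Set (SimpleGraph V) :=
  {G | (G.neighborSet u).ncard = d}

theorem degreeEvent_eq {V : Type*} [Fintype V] (d : ℕ) (u : V) :
    degreeEvent d u = {G | eventCount edgeEvent (star u) G = d} := by
  simp [degreeEvent, ncard_neighborSet_eq_eventCount]

theorem measurableSet_degreeEvent {V : Type*} [Finite V] (d : ℕ) (u : V) :
    MeasurableSet (degreeEvent d u) := by
  cases nonempty_fintype V
  rw [degreeEvent_eq]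
  exact measurableSet_eventCount_eq measurableSet_edgeEvent _ d

theorem numDegree_eq_eventCount {V : Type} [Fintype V] (G : SimpleGraph V) (d : ℕ) :
    numDegree G d = eventCount (degreeEvent d) Finset.univ G := by
  classical
  rw [numDegree, eventCount_eq_card, ← Set.ncard_coe_finset]
  congr 1
  ext v
  rw [Finset.mem_coe, Finset.mem_filter_univ]
  rfl

theorem coinGraph_preimage_edgeEvent {e : Sym2 (Vertex n)} (he : ¬e.IsDiag) :
    coinGraph ⁻¹' edgeEvent e = (fun ω => ω e) ⁻¹' {true} := by
  ext ω
  simp [edgeEvent, coinGraph, he]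

theorem kroneckerGraph_real_edgeEvent (α β γ : I) {e : Sym2 (Vertex n)} (he : ¬e.IsDiag) :
    (kroneckerGraph α β γ n).real (edgeEvent e) = edgeProb α β γ n e := by
  rw [kroneckerGraph, map_measureReal_apply (measurable_coinGraph n) (measurableSet_edgeEvent e),
    coinGraph_preimage_edgeEvent he, coinMeasure,
    (measurePreserving_eval _ e).measureReal_preimage MeasurableSet.of_discrete.nullMeasurableSet,
    bernoulliMeasure_real_apply_of_mem_of_notMem _ .of_discrete (Set.mem_singleton _) (by simp)]

theorem iIndepSet_edgeEvent (α β γ : I) (n : ℕ) :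
    iIndepSet edgeEvent (kroneckerGraph α β γ n) := by
  have hpre (e : Sym2 (Vertex n)) : ∃ B : Set Bool,
      coinGraph ⁻¹' edgeEvent e = (fun ω => ω e) ⁻¹' B := by
    by_cases he : e.IsDiag
    · refine ⟨∅, ?_⟩
      ext ω
      simp [edgeEvent, he]
    · exact ⟨{true}, coinGraph_preimage_edgeEvent he⟩
  choose B hB using hpre
  have hindep : iIndepFun (fun e ω => ω e) (coinMeasure α β γ n) :=
    iIndepFun_pi (X := fun _ => id) fun _ => aemeasurable_id
  rw [iIndepSet_iff_meas_biInter measurableSet_edgeEvent]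
  intro s
  have hmap (S : Set (SimpleGraph (Vertex n))) (hS : MeasurableSet S) :
      kroneckerGraph α β γ n S = coinMeasure α β γ n (coinGraph ⁻¹' S) :=
    Measure.map_apply (measurable_coinGraph n) hS
  rw [hmap _ (Finset.measurableSet_biInter s fun e _ => measurableSet_edgeEvent e),
    Set.preimage_iInter₂]
  simp only [hmap _ (measurableSet_edgeEvent _), hB]
  exact hindep.measure_inter_preimage_eq_mul s fun _ _ => .of_discrete

end

/-! ### The law of a degree -/

section
variable {n : ℕ} {α β γ : I}

theorem kroneckerGraph_real_edgeEvent_le (α β γ : I) (e : Sym2 (Vertex n)) :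
    (kroneckerGraph α β γ n).real (edgeEvent e) ≤ edgeProb α β γ n e := by
  by_cases he : e.IsDiag
  · induction e with | _ u v
    obtain rfl : u = v := he
    simpa [edgeEvent_mk_self] using (edgeProb α β γ n s(u, u)).2.1
  · exact (kroneckerGraph_real_edgeEvent α β γ he).le

theorem coe_edgeProb_mk (α β γ : I) (u v : Vertex n) :
    (edgeProb α β γ n s(u, v) : ℝ) = ∏ k, (probMatrix α β γ (u k) (v k) : ℝ) :=
  map_prod unitInterval.submonoid.subtype (fun k => probMatrix α β γ (u k) (v k)) Finset.univ

theorem edgeProb_mk_le_of_ne {u v : Vertex n} (h : u ≠ v) :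
    (edgeProb α β γ n s(u, v) : ℝ) ≤ β := by
  obtain ⟨k, hk⟩ := Function.ne_iff.1 h
  have hβ : probMatrix α β γ (u k) (v k) = β := by
    generalize u k = i, v k = j at hk
    fin_cases i <;> fin_cases j <;> first | rfl | exact absurd rfl hk
  rw [coe_edgeProb_mk, ← Finset.mul_prod_erase _ _ (Finset.mem_univ k), hβ]
  exact mul_le_of_le_one_right β.2.1
    (Finset.prod_le_one (fun _ _ => unitInterval.nonneg _) fun _ _ => unitInterval.le_one _)

theorem edgeProb_le_pow {q : ℝ} (hq : ∀ i j, (probMatrix α β γ i j : ℝ) ≤ q)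
    (e : Sym2 (Vertex n)) : (edgeProb α β γ n e : ℝ) ≤ q ^ n := by
  induction e with | _ u v
  rw [coe_edgeProb_mk]
  exact (Finset.prod_le_prod (fun _ _ => unitInterval.nonneg _) fun k _ => hq _ _).trans_eq
    (by simp)

/-- The row sums of the probability matrix. -/
noncomputable def rowSum (α β γ : I) (i : Fin 2) : ℝ :=
  ∑ j, (probMatrix α β γ i j : ℝ)

/-- The sum of the edge probabilities at the vertex `u`. It includes the probability of the
diagonal pair, although that pair is never an edge, so as to factor over the digits of `u`. -/
noncomputable def degreeMean (α β γ : I) (u : Vertex n) : ℝ :=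
  ∑ v, (edgeProb α β γ n s(u, v) : ℝ)

theorem rowSum_zero : rowSum α β γ 0 = β + γ := by
  simp [rowSum, probMatrix, add_comm]

theorem rowSum_one : rowSum α β γ 1 = α + β := by
  simp [rowSum, probMatrix, add_comm]

theorem rowSum_pos (hβ : 0 < β) (i : Fin 2) : 0 < rowSum α β γ i := by
  have hβ' : (0 : ℝ) < β := hβ
  fin_cases i
  · exact rowSum_zero.trans_gt (by linarith [γ.2.1])
  · exact rowSum_one.trans_gt (by linarith [α.2.1])

theorem degreeMean_eq_prod_rowSum (u : Vertex n) :
    degreeMean α β γ u = ∏ k, rowSum α β γ (u k) := by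
  simp_rw [degreeMean, coe_edgeProb_mk, rowSum]
  exact (Fintype.prod_sum fun k j => (probMatrix α β γ (u k) j : ℝ)).symm

theorem degreeMean_pos (hβ : 0 < β) (u : Vertex n) : 0 < degreeMean α β γ u := by
  rw [degreeMean_eq_prod_rowSum]
  exact Finset.prod_pos fun _ _ => rowSum_pos hβ _

theorem degreeMean_mul_degreeMean_add_one (u : Vertex n) :
    degreeMean α β γ u * degreeMean α β γ (u + 1) =
      (((α : ℝ) + β) * ((β : ℝ) + γ)) ^ n := by
  have hdigit (i : Fin 2) :
      rowSum α β γ i * rowSum α β γ (i + 1) = ((α : ℝ) + β) * ((β : ℝ) + γ) := by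
    fin_cases i
    · exact (congrArg₂ (· * ·) rowSum_zero rowSum_one).trans (mul_comm _ _)
    · exact congrArg₂ (· * ·) rowSum_one rowSum_zero
  simp_rw [degreeMean_eq_prod_rowSum, ← Finset.prod_mul_distrib, Pi.add_apply, Pi.one_apply, hdigit]
  simp

theorem sum_degreeMean_rpow (hβ : 0 < β) (t : ℝ) :
    ∑ u : Vertex n, degreeMean α β γ u ^ t = (((α : ℝ) + β) ^ t + ((β : ℝ) + γ) ^ t) ^ n := by
  have hprod (u : Vertex n) : degreeMean α β γ u ^ t = ∏ k, rowSum α β γ (u k) ^ t := by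
    rw [degreeMean_eq_prod_rowSum, Real.finsetProd_rpow _ _ fun _ _ => (rowSum_pos hβ _).le]
  simp_rw [hprod]
  rw [← Fintype.prod_sum fun (_ : Fin n) j => rowSum α β γ j ^ t]
  simp [rowSum_zero, rowSum_one, add_comm]

theorem sum_star_kroneckerGraph_real_edgeEvent (u : Vertex n) :
    ∑ e ∈ star u, (kroneckerGraph α β γ n).real (edgeEvent e) =
      degreeMean α β γ u - edgeProb α β γ n s(u, u) := by
  rw [sum_star, degreeMean, ← Finset.add_sum_erase _ _ (Finset.mem_univ u),
    ← Finset.add_sum_erase _ (fun v => (edgeProb α β γ n s(u, v) : ℝ)) (Finset.mem_univ u),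
    edgeEvent_mk_self, measureReal_empty, zero_add, add_sub_cancel_left]
  exact Finset.sum_congr rfl fun v hv =>
    kroneckerGraph_real_edgeEvent α β γ (Finset.ne_of_mem_erase hv).symm

theorem sum_star_kroneckerGraph_real_edgeEvent_le (u : Vertex n) :
    ∑ e ∈ star u, (kroneckerGraph α β γ n).real (edgeEvent e) ≤ degreeMean α β γ u := by
  rw [sum_star_kroneckerGraph_real_edgeEvent]
  exact sub_le_self _ (unitInterval.nonneg _)

theorem kroneckerGraph_real_degreeEvent_le_degreeMean {d : ℕ} (hd : d ≠ 0) (u : Vertex n) :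
    (kroneckerGraph α β γ n).real (degreeEvent d u) ≤ degreeMean α β γ u := by
  rw [degreeEvent_eq]
  exact (measureReal_eventCount_eq_le_sum _ hd).trans
    (sum_star_kroneckerGraph_real_edgeEvent_le u)

theorem kroneckerGraph_real_degreeEvent_le_exp (d : ℕ) (u : Vertex n) :
    (kroneckerGraph α β γ n).real (degreeEvent d u) ≤
      2 ^ d * Real.exp ((1 - degreeMean α β γ u) / 2) := by
  rw [degreeEvent_eq]
  refine (measureReal_eventCount_eq_le_two_pow_mul_exp (iIndepSet_edgeEvent α β γ n)
    measurableSet_edgeEvent _ d).trans ?_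
  rw [sum_star_kroneckerGraph_real_edgeEvent]
  gcongr
  linarith [(edgeProb α β γ n s(u, u)).2.2]

theorem exp_neg_degreeMean_div_le_kroneckerGraph_real_degreeEvent_zero (hβ : β < 1)
    (u : Vertex n) :
    Real.exp (-degreeMean α β γ u / (1 - β)) ≤
      (kroneckerGraph α β γ n).real (degreeEvent 0 u) := by
  have hβ' : (β : ℝ) < 1 := hβ
  rw [degreeEvent_eq]
  refine le_trans ?_ (exp_neg_sum_div_le_measureReal_eventCount_eq_zero
    (iIndepSet_edgeEvent α β γ n) measurableSet_edgeEvent hβ' fun e he => ?_)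
  · have := sub_pos.2 hβ'
    gcongr
    exact sum_star_kroneckerGraph_real_edgeEvent_le u
  · obtain ⟨v, rfl⟩ := mem_star.1 he
    obtain rfl | huv := eq_or_ne u v
    · simpa [edgeEvent_mk_self] using β.2.1
    · exact (kroneckerGraph_real_edgeEvent_le α β γ _).trans (edgeProb_mk_le_of_ne huv)

theorem abs_kroneckerGraph_real_degreeEvent_sub_poissonMeasure_real_le {q : ℝ}
    (hq : ∀ i j, (probMatrix α β γ i j : ℝ) ≤ q) (d : ℕ) (u : Vertex n) :
    |(kroneckerGraph α β γ n).real (degreeEvent d u) -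
        (poissonMeasure (degreeMean α β γ u).toNNReal).real {d}| ≤
      q ^ n * (degreeMean α β γ u + 1) := by
  set μ := kroneckerGraph α β γ n
  set r := ∑ e ∈ star u, (μ (edgeEvent e)).toNNReal
  set p : ℝ := (edgeProb α β γ n s(u, u)).1
  have hedge (e : Sym2 (Vertex n)) : μ.real (edgeEvent e) ≤ q ^ n :=
    (kroneckerGraph_real_edgeEvent_le α β γ e).trans (edgeProb_le_pow hq e)
  have hlecam := abs_measureReal_eventCount_sub_poissonMeasure_real_le
    (iIndepSet_edgeEvent α β γ n) measurableSet_edgeEvent (star u) {d}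
  have hsq : ∑ e ∈ star u, μ.real (edgeEvent e) ^ 2 ≤ q ^ n * degreeMean α β γ u :=
    calc ∑ e ∈ star u, μ.real (edgeEvent e) ^ 2
        ≤ ∑ e ∈ star u, q ^ n * μ.real (edgeEvent e) := Finset.sum_le_sum fun e _ =>
          (sq _).trans_le (mul_le_mul_of_nonneg_right (hedge e) measureReal_nonneg)
      _ = q ^ n * ∑ e ∈ star u, μ.real (edgeEvent e) := (Finset.mul_sum ..).symm
      _ ≤ q ^ n * degreeMean α β γ u := mul_le_mul_of_nonneg_left
          (sum_star_kroneckerGraph_real_edgeEvent_le u)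
          (measureReal_nonneg.trans (hedge s(u, u)))
  have hr : (degreeMean α β γ u).toNNReal = r + p.toNNReal := by
    have : (r : ℝ) = degreeMean α β γ u - p :=
      (NNReal.coe_sum ..).trans (sum_star_kroneckerGraph_real_edgeEvent u)
    rw [eq_add_of_sub_eq this.symm, Real.toNNReal_add r.coe_nonneg (unitInterval.nonneg _),
      Real.toNNReal_coe]
  have hshift := abs_poissonMeasure_add_real_sub_poissonMeasure_real_le r p.toNNReal {d}
  rw [← hr, Real.coe_toNNReal p (unitInterval.nonneg _), abs_sub_comm] at hshift
  rw [degreeEvent_eq]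
  refine (abs_sub_le _ _ _).trans ((add_le_add (hlecam.trans hsq)
    (hshift.trans (edgeProb_le_pow hq _))).trans_eq ?_)
  ring

end

/-! ### The number of vertices of a given degree -/

section
variable {n : ℕ} {α β γ : I}

theorem numDegree_le_card {V : Type} [Fintype V] (G : SimpleGraph V) (d : ℕ) :
    numDegree G d ≤ Fintype.card V :=
  Nat.card_eq_fintype_card (α := V) ▸ Set.ncard_le_card _

theorem memLp_numDegree {V : Type} [Finite V] (μ : Measure (SimpleGraph V)) [IsFiniteMeasure μ]
    (d : ℕ) (p : ENNReal) : MemLp (fun G => (numDegree G d : ℝ)) p μ := by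
  cases nonempty_fintype V
  refine .of_bound ?_ (Fintype.card V) (.of_forall fun G => ?_)
  · simp_rw [numDegree_eq_eventCount]
    exact (measurable_from_top.comp (measurable_eventCount
      (measurableSet_degreeEvent d) Finset.univ)).aestronglyMeasurable
  · simpa using numDegree_le_card G d

theorem expNumDegree_eq_sum (α β γ : I) (d n : ℕ) :
    expNumDegree α β γ d n = ∑ u, (kroneckerGraph α β γ n).real (degreeEvent d u) := by
  simp_rw [expNumDegree, numDegree_eq_eventCount]
  exact integral_eventCount (measurableSet_degreeEvent d) Finset.univ

theorem expNumDegree_nonneg (α β γ : I) (d n : ℕ) : 0 ≤ expNumDegree α β γ d n :=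
  integral_nonneg fun _ => Nat.cast_nonneg _

theorem expNumDegree_le_two_pow (α β γ : I) (d n : ℕ) : expNumDegree α β γ d n ≤ 2 ^ n := by
  rw [expNumDegree_eq_sum]
  exact (Finset.sum_le_sum fun _ _ => measureReal_le_one).trans_eq (by simp)

theorem kroneckerGraph_real_degreeEvent_inter_le {u v : Vertex n} (huv : u ≠ v) (d : ℕ) :
    (kroneckerGraph α β γ n).real (degreeEvent d u ∩ degreeEvent d v) ≤
      (kroneckerGraph α β γ n).real (degreeEvent d u) *
        (kroneckerGraph α β γ n).real (degreeEvent d v) + 3 * edgeProb α β γ n s(u, v) := by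
  classical
  simp_rw [degreeEvent_eq]
  refine (measureReal_eventCount_inter_le (iIndepSet_edgeEvent α β γ n) measurableSet_edgeEvent
    (star u) (star v) d d).trans ?_
  rw [star_inter_star huv, Finset.sum_singleton]
  gcongr
  exact kroneckerGraph_real_edgeEvent_le α β γ _

theorem variance_numDegree_le (d : ℕ) :
    Var[fun G => (numDegree G d : ℝ); kroneckerGraph α β γ n] ≤
      ∑ u : Vertex n, (1 + 3 * degreeMean α β γ u) := by
  simp_rw [numDegree_eq_eventCount]
  rw [variance_eventCount (measurableSet_degreeEvent d)]
  refine Finset.sum_le_sum fun u _ => ?_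
  calc ∑ v, ((kroneckerGraph α β γ n).real (degreeEvent d u ∩ degreeEvent d v) -
          (kroneckerGraph α β γ n).real (degreeEvent d u) *
            (kroneckerGraph α β γ n).real (degreeEvent d v))
      ≤ ∑ v, ((if u = v then 1 else 0) + 3 * (edgeProb α β γ n s(u, v) : ℝ)) := by
        refine Finset.sum_le_sum fun v _ => ?_
        split_ifs with huv
        · have hp : 0 ≤ 3 * (edgeProb α β γ n s(u, v) : ℝ) :=
            mul_nonneg zero_le_three (unitInterval.nonneg _)
          exact (sub_le_self _ (by positivity)).trans
            (measureReal_le_one.trans (le_add_of_nonneg_right hp))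
        · linarith [kroneckerGraph_real_degreeEvent_inter_le (α := α) (β := β) (γ := γ) huv d]
    _ = 1 + 3 * degreeMean α β γ u := by
        rw [Finset.sum_add_distrib, Finset.sum_ite_eq, if_pos (Finset.mem_univ u),
          ← Finset.mul_sum, degreeMean]

end

theorem tendsto_measureReal_lt_abs_sub_of_variance_isLittleO {Ω : ℕ → Type*}
    [∀ n, MeasurableSpace (Ω n)] {μ : ∀ n, Measure (Ω n)} [∀ n, IsProbabilityMeasure (μ n)]
    {X : ∀ n, Ω n → ℝ} {a : ℕ → ℝ} (hX : ∀ n, MemLp (X n) 2 (μ n)) (ha : ∀ n, 0 < a n)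
    (hmean : (fun n => ∫ ω, X n ω ∂μ n) ~[atTop] a)
    (hvar : (fun n => Var[X n; μ n]) =o[atTop] fun n => a n ^ 2) {ε : ℝ} (hε : 0 < ε) :
    Tendsto (fun n => (μ n).real {ω | ε * a n < |X n ω - a n|}) atTop (𝓝 0) := by
  have hratio : Tendsto (fun n => Var[X n; μ n] / a n ^ 2 / (ε / 2) ^ 2) atTop (𝓝 0) := by
    simpa using hvar.tendsto_div_nhds_zero.div_const ((ε / 2) ^ 2)
  refine squeeze_zero' (.of_forall fun n => measureReal_nonneg) ?_ hratio
  filter_upwards [isLittleO_iff.1 hmean (half_pos hε)] with n hn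
  have han := ha n
  rw [Pi.sub_apply, Real.norm_eq_abs, Real.norm_of_nonneg han.le] at hn
  have hsub : {ω | ε * a n < |X n ω - a n|} ⊆
      {ω | ε / 2 * a n ≤ |X n ω - ∫ ω', X n ω' ∂μ n|} := by
    intro ω hω
    rw [Set.mem_ofPred_eq] at hω ⊢
    linarith [abs_sub_le (X n ω) (∫ ω', X n ω' ∂μ n) (a n)]
  refine (measureReal_mono hsub).trans (ENNReal.toReal_le_of_le_ofReal ?_ ?_)
  · exact div_nonneg (div_nonneg (variance_nonneg _ _) (sq_nonneg _)) (sq_nonneg _)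
  · rw [div_div, ← mul_pow, mul_comm (a n)]
    exact meas_ge_le_variance_div_sq (hX n) (by positivity)

section
variable {α β γ : I} {Q Q' : ∀ n, SimpleGraph (Vertex n) → Prop}

theorem AAS.mono (h : AAS α β γ Q) (hQ : ∀ n G, Q n G → Q' n G) : AAS α β γ Q' :=
  tendsto_of_tendsto_of_tendsto_of_le_of_le h tendsto_const_nhds
    (fun n => measureReal_mono (hQ n)) fun _ => measureReal_le_one

theorem AAS.of_tendsto_not
    (h : Tendsto (fun n => (kroneckerGraph α β γ n).real {G | ¬Q n G}) atTop (𝓝 0)) :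
    AAS α β γ Q := by
  refine tendsto_of_tendsto_of_tendsto_of_le_of_le (by simpa using h.const_sub 1)
    tendsto_const_nhds (fun n => ?_) fun _ => measureReal_le_one
  have hone : 1 ≤ (kroneckerGraph α β γ n).real ({G | Q n G} ∪ {G | ¬Q n G}) := by
    rw [← Set.compl_ofPred, Set.union_compl_self, probReal_univ]
  exact sub_le_iff_le_add.2 (hone.trans (measureReal_union_le _ _))

theorem aas_numDegree_lt {d : ℕ}
    (h : expNumDegree α β γ d =o[atTop] fun n : ℕ => (2 : ℝ) ^ n) {c : ℝ} (hc : 0 < c) :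
    AAS α β γ fun n G => (numDegree G d : ℝ) < c * 2 ^ n := by
  refine .of_tendsto_not (squeeze_zero (fun n => measureReal_nonneg) (fun n => ?_)
    (by simpa using h.tendsto_div_nhds_zero.div_const c))
  rw [div_div, le_div_iff₀' (by positivity), mul_comm _ c]
  simp only [not_lt]
  exact mul_meas_ge_le_integral_of_nonneg (.of_forall fun G => Nat.cast_nonneg _)
    ((memLp_numDegree _ d 1).integrable le_rfl) _

theorem aas_abs_numDegree_sub_le {d : ℕ} {a : ℕ → ℝ} (ha : ∀ n, 0 < a n)
    (hmean : expNumDegree α β γ d ~[atTop] a)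
    (hvar : (fun n => Var[fun G => (numDegree G d : ℝ); kroneckerGraph α β γ n]) =o[atTop]
      fun n => a n ^ 2) {ε : ℝ} (hε : 0 < ε) :
    AAS α β γ fun n G => |(numDegree G d : ℝ) - a n| ≤ ε * a n :=
  .of_tendsto_not (by
    simpa only [not_le] using tendsto_measureReal_lt_abs_sub_of_variance_isLittleO
      (fun n => memLp_numDegree (kroneckerGraph α β γ n) d 2) ha hmean hvar hε)

end

/-! ### Anticoncentration of digit sums -/

section
variable {n : ℕ}

theorem two_mul_add_one_mul_centralBinom_sq_le (k : ℕ) :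
    (2 * k + 1) * k.centralBinom ^ 2 ≤ 16 ^ k := by
  induction k with
  | zero => simp
  | succ k ih =>
    refine Nat.le_of_mul_le_mul_left (c := (k + 1) ^ 2) ?_ (by positivity)
    calc (k + 1) ^ 2 * ((2 * (k + 1) + 1) * (k + 1).centralBinom ^ 2)
        = (2 * (k + 1) + 1) * ((k + 1) * (k + 1).centralBinom) ^ 2 := by ring
      _ = (2 * (k + 1) + 1) * (2 * k + 1) * 4 * ((2 * k + 1) * k.centralBinom ^ 2) := by
          rw [Nat.succ_mul_centralBinom_succ]; ring
      _ ≤ (4 * (k + 1) ^ 2) * 4 * 16 ^ k := by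
          have hk : (2 * (k + 1) + 1) * (2 * k + 1) ≤ 4 * (k + 1) ^ 2 := by nlinarith
          gcongr
      _ = (k + 1) ^ 2 * 16 ^ (k + 1) := by ring

theorem two_mul_add_one_choose_le (k r : ℕ) : (2 * k + 1).choose r ≤ 2 * k.centralBinom := by
  cases r with
  | zero =>
    rw [Nat.choose_zero_right]
    linarith [k.centralBinom_pos]
  | succ r =>
    rw [Nat.choose_succ_succ']
    linarith [Nat.choose_le_centralBinom r k, Nat.choose_le_centralBinom (r + 1) k]

theorem mul_choose_sq_le (n r : ℕ) : n * n.choose r ^ 2 ≤ 4 ^ n := by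
  obtain ⟨k, rfl | rfl⟩ := n.even_or_odd'
  · calc 2 * k * (2 * k).choose r ^ 2 ≤ (2 * k + 1) * k.centralBinom ^ 2 := by
          gcongr
          · exact Nat.le_succ _
          · exact Nat.choose_le_centralBinom r k
      _ ≤ 16 ^ k := two_mul_add_one_mul_centralBinom_sq_le k
      _ = 4 ^ (2 * k) := pow_mul 4 2 k |>.symm
  · calc (2 * k + 1) * (2 * k + 1).choose r ^ 2 ≤ (2 * k + 1) * (2 * k.centralBinom) ^ 2 := by
          gcongr
          exact two_mul_add_one_choose_le k r
      _ = 4 * ((2 * k + 1) * k.centralBinom ^ 2) := by ring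
      _ ≤ 4 * 16 ^ k := by gcongr; exact two_mul_add_one_mul_centralBinom_sq_le k
      _ = 4 ^ (2 * k + 1) := by rw [pow_succ', pow_mul]; rfl

theorem choose_le_two_pow_div_sqrt (hn : n ≠ 0) (r : ℕ) : (n.choose r : ℝ) ≤ 2 ^ n / √n := by
  have hn' : 0 < √(n : ℝ) := Real.sqrt_pos.2 (Nat.cast_pos.2 hn.bot_lt)
  rw [le_div_iff₀ hn', mul_comm]
  refine le_of_sq_le_sq ?_ (by positivity)
  rw [mul_pow, Real.sq_sqrt n.cast_nonneg, pow_right_comm]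
  norm_num only
  exact_mod_cast mul_choose_sq_le n r

/-- The number of ones in a binary string. -/
def weight (u : Vertex n) : ℕ :=
  (Finset.univ.filter fun k => u k = 1).card

theorem card_filter_weight_eq (n w : ℕ) :
    (Finset.univ.filter fun u : Vertex n => weight u = w).card = n.choose w := by
  have hw : (Finset.powersetCard w (Finset.univ : Finset (Fin n))).card = n.choose w := by simp
  rw [← hw]
  refine Finset.card_nbij' (fun u => Finset.univ.filter fun k => u k = 1)
    (fun s k => if k ∈ s then 1 else 0) ?_ ?_ ?_ ?_
  · intro u hu
    rw [Finset.mem_coe, Finset.mem_filter_univ] at hu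
    exact Finset.mem_coe.2 (Finset.mem_powersetCard_univ.2 hu)
  · intro s hs
    rw [Finset.mem_coe, Finset.mem_powersetCard_univ] at hs
    rw [Finset.mem_coe, Finset.mem_filter_univ]
    simpa [weight] using hs
  · intro u _
    ext k
    obtain hk | hk := Fin.exists_fin_two.1 ⟨u k, rfl⟩ <;> simp [hk]
  · intro s _
    ext k
    simp

theorem card_filter_weight_mem_le (hn : n ≠ 0) (W : Finset ℕ) :
    ((Finset.univ.filter fun u : Vertex n => weight u ∈ W).card : ℝ) ≤
      W.card * (2 ^ n / √n) := by
  have hfiber (w : ℕ) (hw : w ∈ W) :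
      ((Finset.univ.filter fun u : Vertex n => weight u ∈ W).filter (weight · = w)).card =
        n.choose w := by
    rw [Finset.filter_filter, ← card_filter_weight_eq]
    congr 2 with u
    exact and_iff_right_of_imp fun h => h ▸ hw
  rw [Finset.card_eq_sum_card_fiberwise (f := weight) (t := W) (by intro u hu; simpa using hu),
    Finset.sum_congr rfl hfiber, Nat.cast_sum, ← nsmul_eq_mul]
  exact Finset.sum_le_card_nsmul _ _ _ fun w _ => choose_le_two_pow_div_sqrt hn w

theorem sum_eq_add_weight_mul (z : Fin 2 → ℝ) (u : Vertex n) :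
    ∑ k, z (u k) = n * z 0 + weight u * (z 1 - z 0) := by
  have hdigit (i : Fin 2) : z i = z 0 + if i = 1 then z 1 - z 0 else 0 := by
    fin_cases i <;> simp
  simp_rw [hdigit (u _), Finset.sum_add_distrib, ← Finset.sum_filter]
  simp [weight, mul_sub]

theorem card_le_of_forall_abs_add_mul_le {x c L : ℝ} (hc : c ≠ 0) {W : Finset ℕ}
    (hW : ∀ w ∈ W, |x + w * c| ≤ L) : W.card ≤ ⌊2 * L / |c|⌋₊ + 1 := by
  obtain rfl | hne := W.eq_empty_or_nonempty
  · simp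
  set v := W.min' hne
  have hsub : W ⊆ Finset.Icc v (v + ⌊2 * L / |c|⌋₊) := by
    intro w hw
    have hvw : v ≤ w := W.min'_le w hw
    have hdist : ((w - v : ℕ) : ℝ) * |c| ≤ 2 * L := by
      have hdiff : ((w - v : ℕ) : ℝ) * c = (x + w * c) - (x + v * c) := by
        rw [Nat.cast_sub hvw]; ring
      rw [← Nat.abs_cast, ← abs_mul, hdiff, two_mul]
      exact (abs_sub _ _).trans (add_le_add (hW w hw) (hW v (W.min'_mem hne)))
    have hfloor := Nat.le_floor ((le_div_iff₀ (abs_pos.2 hc)).2 hdist)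
    exact Finset.mem_Icc.2 ⟨hvw, by omega⟩
  refine (Finset.card_le_card hsub).trans ?_
  rw [Nat.card_Icc]
  omega

theorem card_filter_abs_sum_le {z : Fin 2 → ℝ} (hz : z 0 ≠ z 1) (hn : n ≠ 0) (L : ℝ) :
    ((Finset.univ.filter fun u : Vertex n => |∑ k, z (u k)| ≤ L).card : ℝ) ≤
      (⌊2 * L / |z 1 - z 0|⌋₊ + 1) * (2 ^ n / √n) := by
  set S := Finset.univ.filter fun u : Vertex n => |∑ k, z (u k)| ≤ L
  have hW : (S.image weight).card ≤ ⌊2 * L / |z 1 - z 0|⌋₊ + 1 := by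
    refine card_le_of_forall_abs_add_mul_le (x := n * z 0) (sub_ne_zero.2 hz.symm) ?_
    simp [S, sum_eq_add_weight_mul]
  have hS : S ⊆ Finset.univ.filter fun u => weight u ∈ S.image weight := fun u hu =>
    Finset.mem_filter.2 ⟨Finset.mem_univ u, Finset.mem_image_of_mem _ hu⟩
  calc (S.card : ℝ)
      ≤ (S.image weight).card * (2 ^ n / √n) :=
        (Nat.cast_le.2 (Finset.card_le_card hS)).trans (card_filter_weight_mem_le hn _)
    _ ≤ (⌊2 * L / |z 1 - z 0|⌋₊ + 1) * (2 ^ n / √n) := by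
        gcongr
        exact_mod_cast hW

theorem isLittleO_card_filter_abs_sum_le {z : Fin 2 → ℝ} (hz : z ≠ 0) (L : ℝ) :
    (fun n : ℕ => ((Finset.univ.filter fun u : Vertex n => |∑ k, z (u k)| ≤ L).card : ℝ))
      =o[atTop] fun n : ℕ => (2 : ℝ) ^ n := by
  by_cases h : z 0 = z 1
  · have h0 : z 0 ≠ 0 := fun h0 => hz (by ext i; fin_cases i; exacts [h0, h.symm.trans h0])
    refine (isLittleO_zero _ _).congr' ?_ .rfl
    filter_upwards [(tendsto_natCast_atTop_atTop.atTop_mul_const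
      (abs_pos.2 h0)).eventually_gt_atTop L] with n hn
    have hsum (u : Vertex n) : |∑ k, z (u k)| = n * |z 0| := by
      rw [sum_eq_add_weight_mul, ← h, sub_self, mul_zero, add_zero, abs_mul, Nat.abs_cast]
    simp [hsum, hn.not_ge]
  · rw [isLittleO_iff_tendsto fun n hn => absurd hn (by positivity)]
    have hlim : Tendsto (fun n : ℕ => (⌊2 * L / |z 1 - z 0|⌋₊ + 1) * (√(n : ℝ))⁻¹) atTop (𝓝 0) :=
      mul_zero (⌊2 * L / |z 1 - z 0|⌋₊ + 1 : ℝ) ▸ ((tendsto_inv_atTop_zero.comp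
        Real.tendsto_sqrt_atTop).comp tendsto_natCast_atTop_atTop).const_mul _
    refine squeeze_zero' (.of_forall fun n => by positivity) ?_ hlim
    filter_upwards [eventually_ne_atTop 0] with n hn
    rw [div_le_iff₀ (by positivity)]
    exact (card_filter_abs_sum_le h hn L).trans_eq (by ring)

theorem isLittleO_sum_of_le_of_lt_abs_sum {z : Fin 2 → ℝ} (hz : z ≠ 0) {f : ∀ n, Vertex n → ℝ}
    (hf₀ : ∀ n u, 0 ≤ f n u) (hf₁ : ∀ n u, f n u ≤ 1)
    (hf : ∀ δ > 0, ∃ L : ℝ, ∀ n u, L < |∑ k, z (u k)| → f n u ≤ δ) :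
    (fun n => ∑ u, f n u) =o[atTop] fun n : ℕ => (2 : ℝ) ^ n := by
  rw [isLittleO_iff]
  intro δ hδ
  obtain ⟨L, hL⟩ := hf (δ / 2) (half_pos hδ)
  filter_upwards [isLittleO_iff.1 (isLittleO_card_filter_abs_sum_le hz L) (half_pos hδ)] with n hn
  rw [Real.norm_of_nonneg (Nat.cast_nonneg _), Real.norm_of_nonneg (by positivity)] at hn
  rw [Real.norm_of_nonneg (Finset.sum_nonneg fun u _ => hf₀ n u),
    Real.norm_of_nonneg (by positivity)]
  calc ∑ u, f n u ≤ ∑ u : Vertex n, ((if |∑ k, z (u k)| ≤ L then 1 else 0) + δ / 2) := by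
        refine Finset.sum_le_sum fun u _ => ?_
        split_ifs with h
        · linarith [hf₁ n u]
        · linarith [hL n u (not_le.1 h)]
    _ = (Finset.univ.filter fun u : Vertex n => |∑ k, z (u k)| ≤ L).card + δ / 2 * 2 ^ n := by
        rw [Finset.sum_add_distrib, Finset.sum_boole]
        simp [mul_comm]
    _ ≤ δ * 2 ^ n := by linarith

end

/-! ### The expected number of vertices of a given degree -/

section

theorem exp_neg_le_rpow_neg {x t : ℝ} (hx : 0 < x) (ht₀ : 0 ≤ t) (ht₁ : t ≤ 1) :
    Real.exp (-x) ≤ x ^ (-t) := by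
  obtain h | h := le_total x 1
  · exact (Real.exp_le_one_iff.2 (neg_nonpos.2 hx.le)).trans
      (Real.one_le_rpow_of_pos_of_le_one_of_nonpos hx h (neg_nonpos.2 ht₀))
  · calc Real.exp (-x) ≤ x ^ (-1 : ℝ) := by
          rw [Real.exp_neg, Real.rpow_neg_one]
          exact inv_anti₀ hx (by linarith [Real.add_one_le_exp x])
      _ ≤ x ^ (-t) := Real.rpow_le_rpow_of_exponent_le h (neg_le_neg ht₁)

/- The function `t ↦ a ^ (-t) + b ^ (-t)` has the value `2` and the negative derivative
`-log (a * b)` at `0`. -/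
theorem exists_rpow_neg_add_rpow_neg_lt_two {a b : ℝ} (ha : 0 < a) (hb : 0 < b)
    (hab : 1 < a * b) : ∃ t : ℝ, 0 < t ∧ t ≤ 1 ∧ a ^ (-t) + b ^ (-t) < 2 := by
  have hderiv {c : ℝ} (hc : 0 < c) : HasDerivAt (fun t : ℝ => c ^ (-t)) (-Real.log c) 0 := by
    simpa using (hasDerivAt_neg (0 : ℝ)).const_rpow hc
  have hneg : -Real.log a + -Real.log b < 0 := by
    rw [← neg_add, ← Real.log_mul ha.ne' hb.ne']
    exact neg_neg_of_pos (Real.log_pos hab)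
  have hslope := (hasDerivAt_iff_tendsto_slope.1 ((hderiv ha).add (hderiv hb))).mono_left
    (nhdsWithin_mono 0 fun t (ht : t ∈ Set.Ioi 0) => (Set.mem_Ioi.1 ht).ne')
  have hle : ∀ᶠ t in 𝓝[>] (0 : ℝ), t ≤ 1 := nhdsWithin_le_nhds (eventually_le_nhds one_pos)
  obtain ⟨t, ht, ht₁, ht₀ : 0 < t⟩ :=
    ((hslope.eventually_lt_const hneg).and (hle.and self_mem_nhdsWithin)).exists
  rw [slope_def_field, sub_zero, div_lt_iff₀ ht₀, zero_mul, sub_neg] at ht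
  refine ⟨t, ht₀, ht₁, ht.trans_eq ?_⟩
  simp [one_add_one_eq_two]

end

section
variable {α β γ : I}

theorem degreeMean_eq_exp_sum_log_rowSum {n : ℕ} (hβ : 0 < β) (u : Vertex n) :
    degreeMean α β γ u = Real.exp (∑ k, Real.log (rowSum α β γ (u k))) := by
  rw [degreeMean_eq_prod_rowSum, Real.exp_sum]
  exact Finset.prod_congr rfl fun k _ => (Real.exp_log (rowSum_pos hβ _)).symm

theorem log_rowSum_ne_zero (hβ : 0 < β) (h : ¬((α : ℝ) + β = 1 ∧ (β : ℝ) + γ = 1)) :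
    (fun i => Real.log (rowSum α β γ i)) ≠ 0 := by
  refine fun h0 => h ?_
  have hone (i : Fin 2) : rowSum α β γ i = 1 :=
    Real.eq_one_of_pos_of_log_eq_zero (rowSum_pos hβ i) (congrFun h0 i)
  exact ⟨rowSum_one.symm.trans (hone 1), rowSum_zero.symm.trans (hone 0)⟩

theorem exists_forall_kroneckerGraph_real_degreeEvent_le (hβ : 0 < β) {d : ℕ} (hd : d ≠ 0) {δ : ℝ}
    (hδ : 0 < δ) :
    ∃ L : ℝ, ∀ n (u : Vertex n), L < |∑ k, Real.log (rowSum α β γ (u k))| →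
      (kroneckerGraph α β γ n).real (degreeEvent d u) ≤ δ := by
  have hsmall : Tendsto (fun L : ℝ => Real.exp (-L)) atTop (𝓝 0) :=
    Real.tendsto_exp_neg_atTop_nhds_zero
  have hlarge : Tendsto (fun L : ℝ => 2 ^ d * Real.exp ((1 - Real.exp L) / 2)) atTop (𝓝 0) :=
    mul_zero ((2 : ℝ) ^ d) ▸ (Real.tendsto_exp_atBot.comp ((tendsto_atBot_add_const_left _ 1
      (tendsto_neg_atTop_atBot.comp Real.tendsto_exp_atTop)).atBot_div_const two_pos)).const_mul _
  obtain ⟨L, hL, hL'⟩ :=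
    ((hsmall.eventually_le_const hδ).and (hlarge.eventually_le_const hδ)).exists
  refine ⟨L, fun n u hu => ?_⟩
  obtain h | h := lt_abs.1 hu
  · refine (kroneckerGraph_real_degreeEvent_le_exp d u).trans (le_trans ?_ hL')
    rw [degreeMean_eq_exp_sum_log_rowSum hβ]
    gcongr
  · refine (kroneckerGraph_real_degreeEvent_le_degreeMean hd u).trans (le_trans ?_ hL)
    rw [degreeMean_eq_exp_sum_log_rowSum hβ]
    exact Real.exp_le_exp.2 (by linarith)

theorem isLittleO_expNumDegree_of_ne_zero (hβ : 0 < β)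
    (h : ¬((α : ℝ) + β = 1 ∧ (β : ℝ) + γ = 1)) {d : ℕ} (hd : d ≠ 0) :
    expNumDegree α β γ d =o[atTop] fun n : ℕ => (2 : ℝ) ^ n :=
  (isLittleO_sum_of_le_of_lt_abs_sum (log_rowSum_ne_zero hβ h) (fun _ _ => measureReal_nonneg)
    (fun _ _ => measureReal_le_one) fun _ hδ =>
      exists_forall_kroneckerGraph_real_degreeEvent_le hβ hd hδ).congr_left
    fun n => (expNumDegree_eq_sum α β γ d n).symm

theorem expNumDegree_le_rpow (hβ : 0 < β) {t : ℝ} (ht₀ : 0 ≤ t) (ht₁ : t ≤ 1) (d n : ℕ) :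
    expNumDegree α β γ d n ≤ 2 ^ d * Real.exp (1 / 2) * 2 ^ t *
      (((α : ℝ) + β) ^ (-t) + ((β : ℝ) + γ) ^ (-t)) ^ n := by
  rw [expNumDegree_eq_sum, ← sum_degreeMean_rpow hβ, Finset.mul_sum]
  refine Finset.sum_le_sum fun u _ => (kroneckerGraph_real_degreeEvent_le_exp d u).trans ?_
  have hm := degreeMean_pos (α := α) (γ := γ) hβ u
  calc 2 ^ d * Real.exp ((1 - degreeMean α β γ u) / 2)
      = 2 ^ d * Real.exp (1 / 2) * Real.exp (-(degreeMean α β γ u / 2)) := by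
        rw [mul_assoc, ← Real.exp_add]
        ring_nf
    _ ≤ 2 ^ d * Real.exp (1 / 2) * (degreeMean α β γ u / 2) ^ (-t) := by
        gcongr
        exact exp_neg_le_rpow_neg (half_pos hm) ht₀ ht₁
    _ = 2 ^ d * Real.exp (1 / 2) * 2 ^ t * degreeMean α β γ u ^ (-t) := by
        rw [Real.div_rpow hm.le zero_le_two, Real.rpow_neg zero_le_two, div_inv_eq_mul]
        ring

theorem isLittleO_expNumDegree_of_one_lt_mul (hβ : 0 < β)
    (h : 1 < ((α : ℝ) + β) * ((β : ℝ) + γ)) (d : ℕ) :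
    expNumDegree α β γ d =o[atTop] fun n : ℕ => (2 : ℝ) ^ n := by
  have ha : 0 < (α : ℝ) + β := rowSum_one (γ := γ) ▸ rowSum_pos hβ 1
  have hb : 0 < (β : ℝ) + γ := rowSum_zero (α := α) ▸ rowSum_pos hβ 0
  obtain ⟨t, ht₀, ht₁, ht⟩ := exists_rpow_neg_add_rpow_neg_lt_two ha hb h
  refine IsBigO.trans_isLittleO (.of_bound (2 ^ d * Real.exp (1 / 2) * 2 ^ t)
    (.of_forall fun n => ?_)) (isLittleO_pow_pow_of_lt_left (by positivity) ht)
  rw [Real.norm_of_nonneg (expNumDegree_nonneg α β γ d n), Real.norm_of_nonneg (by positivity)]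
  exact expNumDegree_le_rpow hβ ht₀.le ht₁ d n

/- The means at a string and at its complement multiply to at most `1`, so one of the two strings
has mean at most `1` and is isolated with probability bounded below. -/
theorem two_pow_mul_exp_le_two_mul_expNumDegree_zero (hβ₀ : 0 < β) (hβ₁ : β < 1)
    (h : ((α : ℝ) + β) * ((β : ℝ) + γ) ≤ 1) (n : ℕ) :
    2 ^ n * Real.exp (-1 / (1 - β)) ≤ 2 * expNumDegree α β γ 0 n := by
  set P : Vertex n → ℝ := fun u => (kroneckerGraph α β γ n).real (degreeEvent 0 u)
  have hisolated (u : Vertex n) (hu : degreeMean α β γ u ≤ 1) : Real.exp (-1 / (1 - β)) ≤ P u := by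
    refine le_trans ?_ (exp_neg_degreeMean_div_le_kroneckerGraph_real_degreeEvent_zero hβ₁ u)
    have : 0 < 1 - (β : ℝ) := sub_pos.2 hβ₁
    gcongr
  have hpair (u : Vertex n) : Real.exp (-1 / (1 - β)) ≤ P u + P (u + 1) := by
    obtain hu | hu := le_or_gt (degreeMean α β γ u) 1
    · exact (hisolated u hu).trans (le_add_of_nonneg_right measureReal_nonneg)
    · refine (hisolated (u + 1) ?_).trans (le_add_of_nonneg_left measureReal_nonneg)
      have hprod : degreeMean α β γ u * degreeMean α β γ (u + 1) ≤ 1 := by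
        rw [degreeMean_mul_degreeMean_add_one]
        refine pow_le_one₀ (mul_nonneg ?_ ?_) h
        exacts [add_nonneg α.2.1 β.2.1, add_nonneg β.2.1 γ.2.1]
      exact (le_mul_of_one_le_left (degreeMean_pos hβ₀ _).le hu.le).trans hprod
  have hshift : ∑ u, P (u + 1) = ∑ u, P u := Equiv.sum_comp (Equiv.addRight 1) P
  calc 2 ^ n * Real.exp (-1 / (1 - β)) = ∑ _u : Vertex n, Real.exp (-1 / (1 - β)) := by simp
    _ ≤ ∑ u, (P u + P (u + 1)) := Finset.sum_le_sum fun u _ => hpair u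
    _ = 2 * expNumDegree α β γ 0 n := by
        rw [Finset.sum_add_distrib, hshift, expNumDegree_eq_sum, two_mul]

theorem isTheta_expNumDegree_zero (hβ₀ : 0 < β) (hβ₁ : β < 1)
    (h : ((α : ℝ) + β) * ((β : ℝ) + γ) ≤ 1) :
    expNumDegree α β γ 0 =Θ[atTop] fun n : ℕ => (2 : ℝ) ^ n := by
  refine ⟨.of_norm_le fun n => ?_, .of_bound (2 / Real.exp (-1 / (1 - β))) (.of_forall fun n => ?_)⟩
  · rw [Real.norm_of_nonneg (expNumDegree_nonneg α β γ 0 n)]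
    exact expNumDegree_le_two_pow α β γ 0 n
  · rw [Real.norm_of_nonneg (expNumDegree_nonneg α β γ 0 n), Real.norm_of_nonneg (by positivity),
      div_mul_eq_mul_div, le_div_iff₀ (Real.exp_pos _)]
    exact two_pow_mul_exp_le_two_mul_expNumDegree_zero hβ₀ hβ₁ h n

end

/-! ### The Poisson profile -/

section
variable {n : ℕ} {α β γ : I}

theorem degreeMean_eq_one (h₁ : (α : ℝ) + β = 1) (h₀ : (β : ℝ) + γ = 1) (u : Vertex n) :
    degreeMean α β γ u = 1 := by
  have hrow (i : Fin 2) : rowSum α β γ i = 1 := by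
    fin_cases i
    exacts [rowSum_zero.trans h₀, rowSum_one.trans h₁]
  rw [degreeMean_eq_prod_rowSum, Finset.prod_eq_one fun k _ => hrow (u k)]

theorem probMatrix_le_max (h₁ : (α : ℝ) + β = 1) (h₀ : (β : ℝ) + γ = 1) (i j : Fin 2) :
    (probMatrix α β γ i j : ℝ) ≤ max (β : ℝ) (1 - β) := by
  rw [← eq_sub_iff_add_eq] at h₁
  rw [← eq_sub_iff_add_eq'] at h₀
  fin_cases i <;> fin_cases j <;> simp [probMatrix, h₀, h₁]

theorem poissonMeasure_one_real_singleton (d : ℕ) :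
    (poissonMeasure 1).real {d} = 1 / (Real.exp 1 * d.factorial) := by
  rw [poissonMeasure_real_singleton, NNReal.coe_one, Real.exp_neg, one_pow]
  field_simp

theorem abs_kroneckerGraph_real_degreeEvent_sub_le (h₁ : (α : ℝ) + β = 1)
    (h₀ : (β : ℝ) + γ = 1) (d : ℕ) (u : Vertex n) :
    |(kroneckerGraph α β γ n).real (degreeEvent d u) - 1 / (Real.exp 1 * d.factorial)| ≤
      2 * max (β : ℝ) (1 - β) ^ n := by
  have h := abs_kroneckerGraph_real_degreeEvent_sub_poissonMeasure_real_le
    (probMatrix_le_max h₁ h₀) d u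
  rw [degreeMean_eq_one h₁ h₀, Real.toNNReal_one, poissonMeasure_one_real_singleton] at h
  exact h.trans_eq (by ring)

theorem abs_expNumDegree_sub_le (h₁ : (α : ℝ) + β = 1) (h₀ : (β : ℝ) + γ = 1) (d n : ℕ) :
    |expNumDegree α β γ d n - 2 ^ n / (Real.exp 1 * d.factorial)| ≤
      2 * max (β : ℝ) (1 - β) ^ n * 2 ^ n :=
  calc |expNumDegree α β γ d n - 2 ^ n / (Real.exp 1 * d.factorial)|
      = |∑ u : Vertex n, ((kroneckerGraph α β γ n).real (degreeEvent d u) -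
          1 / (Real.exp 1 * d.factorial))| := by
        rw [expNumDegree_eq_sum, Finset.sum_sub_distrib]
        simp [div_eq_mul_inv]
    _ ≤ ∑ _u : Vertex n, 2 * max (β : ℝ) (1 - β) ^ n :=
        (Finset.abs_sum_le_sum_abs _ _).trans (Finset.sum_le_sum fun u _ =>
          abs_kroneckerGraph_real_degreeEvent_sub_le h₁ h₀ d u)
    _ = 2 * max (β : ℝ) (1 - β) ^ n * 2 ^ n := by simp [mul_comm]

theorem isTheta_two_pow_div_exp_one_mul_factorial (d : ℕ) :
    (fun n : ℕ => (2 : ℝ) ^ n / (Real.exp 1 * (d.factorial : ℝ))) =Θ[atTop]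
      fun n : ℕ => (2 : ℝ) ^ n := by
  simp_rw [div_eq_inv_mul]
  exact (isTheta_const_mul_left (by positivity)).2 (isTheta_refl _ _)

theorem isEquivalent_expNumDegree (hβ₀ : 0 < β) (hβ₁ : β < 1) (h₁ : (α : ℝ) + β = 1)
    (h₀ : (β : ℝ) + γ = 1) (d : ℕ) :
    expNumDegree α β γ d ~[atTop] fun n : ℕ => (2 : ℝ) ^ n / (Real.exp 1 * (d.factorial : ℝ)) := by
  have hmax : max (β : ℝ) (1 - β) < 1 := max_lt hβ₁ (sub_lt_self 1 hβ₀)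
  have hpow : (fun n : ℕ => 2 * max (β : ℝ) (1 - β) ^ n) =o[atTop] fun _ => (1 : ℝ) := by
    refine (isLittleO_one_iff ℝ).2 (mul_zero (2 : ℝ) ▸ Tendsto.const_mul 2 ?_)
    exact tendsto_pow_atTop_nhds_zero_of_lt_one (le_max_of_le_left β.2.1) hmax
  refine IsBigO.trans_isLittleO (.of_norm_le fun n => abs_expNumDegree_sub_le h₁ h₀ d n) ?_
  simpa using hpow.mul_isBigO (isTheta_two_pow_div_exp_one_mul_factorial d).2

theorem variance_numDegree_isLittleO (h₁ : (α : ℝ) + β = 1) (h₀ : (β : ℝ) + γ = 1) (d : ℕ) :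
    (fun n => Var[fun G => (numDegree G d : ℝ); kroneckerGraph α β γ n]) =o[atTop]
      fun n : ℕ => ((2 : ℝ) ^ n / (Real.exp 1 * (d.factorial : ℝ))) ^ 2 := by
  have hvar (n : ℕ) :
      Var[fun G => (numDegree G d : ℝ); kroneckerGraph α β γ n] ≤ 4 * 2 ^ n := by
    refine (variance_numDegree_le d).trans_eq ?_
    simp only [degreeMean_eq_one h₁ h₀, Finset.sum_const, Finset.card_univ, Fintype.card_fun,
      Fintype.card_fin, nsmul_eq_mul, Nat.cast_pow, Nat.cast_ofNat]
    ring
  have hpow : (fun n : ℕ => (2 : ℝ) ^ n) =o[atTop] fun n : ℕ => ((2 : ℝ) ^ n) ^ 2 := by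
    simp_rw [pow_right_comm _ _ 2]
    exact isLittleO_pow_pow_of_lt_left zero_le_two (by norm_num)
  refine (IsBigO.of_bound 4 (.of_forall fun n => ?_)).trans_isLittleO
    (hpow.trans_isBigO ((isTheta_two_pow_div_exp_one_mul_factorial d).2.pow 2))
  rw [Real.norm_of_nonneg (variance_nonneg _ _), Real.norm_of_nonneg (by positivity)]
  exact hvar n

theorem aas_abs_numDegree_sub_two_pow_div_le (hβ₀ : 0 < β) (hβ₁ : β < 1)
    (h₁ : (α : ℝ) + β = 1) (h₀ : (β : ℝ) + γ = 1) (d : ℕ) {ε : ℝ} (hε : 0 < ε) :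
    AAS α β γ fun n G => |(numDegree G d : ℝ) - (2 : ℝ) ^ n / (Real.exp 1 * (d.factorial : ℝ))| ≤
      ε * ((2 : ℝ) ^ n / (Real.exp 1 * (d.factorial : ℝ))) :=
  aas_abs_numDegree_sub_le (fun _ => by positivity) (isEquivalent_expNumDegree hβ₀ hβ₁ h₁ h₀ d)
    (variance_numDegree_isLittleO h₁ h₀ d) hε

theorem isTheta_expNumDegree (hβ₀ : 0 < β) (hβ₁ : β < 1) (h₁ : (α : ℝ) + β = 1)
    (h₀ : (β : ℝ) + γ = 1) (d : ℕ) :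
    expNumDegree α β γ d =Θ[atTop] fun n : ℕ => (2 : ℝ) ^ n :=
  (isEquivalent_expNumDegree hβ₀ hβ₁ h₁ h₀ d).isTheta.trans
    (isTheta_two_pow_div_exp_one_mul_factorial d)

end

/-! ### Power laws and the dichotomy -/

section
variable {α β γ : I}

theorem exists_two_div_factorial_lt_mul_rpow_neg (T : ℝ) {c : ℝ} (hc : 0 < c) (d₀ : ℕ) :
    ∃ D : ℕ, d₀ ≤ D ∧ 2 / (Real.exp 1 * D.factorial) < c * (D : ℝ) ^ (-T) := by
  have hexp : Tendsto (fun D : ℕ => (D : ℝ) ^ T / Real.exp D) atTop (𝓝 0) :=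
    (isLittleO_rpow_exp_atTop T).tendsto_div_nhds_zero.comp tendsto_natCast_atTop_atTop
  have hlim := (hexp.mul (FloorSemiring.tendsto_pow_div_factorial_atTop (Real.exp 1))).mul_const
    (2 / Real.exp 1)
  rw [zero_mul, zero_mul] at hlim
  obtain ⟨D, hD, hd₀, hpos⟩ := ((hlim.eventually_lt_const hc).and
    ((eventually_ge_atTop d₀).and (eventually_gt_atTop 0))).exists
  have hpow : 0 < (D : ℝ) ^ T := Real.rpow_pos_of_pos (Nat.cast_pos.2 hpos) T
  refine ⟨D, hd₀, ?_⟩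
  rw [Real.rpow_neg D.cast_nonneg, ← div_eq_mul_inv, lt_div_iff₀ hpow]
  refine lt_of_eq_of_lt ?_ hD
  rw [← Real.exp_nat_mul, mul_one]
  field_simp

theorem not_isPowerLaw_of_numDegree_lt {V : Type} {G : SimpleGraph V} {c₀ T c τ ε : ℝ}
    {d₀ D : ℕ} (hc₀ : 0 ≤ c₀) (hε : ε ≤ 1) (hD₁ : 1 ≤ D) (hD : d₀ ≤ D) (hc : c₀ ≤ c) (hτ : τ ≤ T)
    (h : (numDegree G D : ℝ) < (1 - ε) * c₀ * (D : ℝ) ^ (-T) * Nat.card V) :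
    ¬IsPowerLaw G c τ ε d₀ D := by
  intro hG
  have hlower := (abs_le.1 (hG D hD le_rfl)).1
  have hD₁' : (1 : ℝ) ≤ D := Nat.one_le_cast.2 hD₁
  have hmono : (1 - ε) * c₀ * (D : ℝ) ^ (-T) * Nat.card V ≤
      (1 - ε) * c * (D : ℝ) ^ (-τ) * Nat.card V := by
    have := sub_nonneg.2 hε
    have := hc₀.trans hc
    gcongr
  linarith

theorem exists_aas_numDegree_lt (hβ₀ : 0 < β) (hβ₁ : β < 1) {c : ℝ} (hc : 0 < c) (T : ℝ)
    {d₀ : ℕ} (hd₀ : 1 ≤ d₀) :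
    ∃ D : ℕ, d₀ ≤ D ∧
      AAS α β γ fun n G => (numDegree G D : ℝ) < c * (D : ℝ) ^ (-T) * 2 ^ n := by
  by_cases h : (α : ℝ) + β = 1 ∧ (β : ℝ) + γ = 1
  · obtain ⟨D, hD, hlt⟩ := exists_two_div_factorial_lt_mul_rpow_neg T hc d₀
    refine ⟨D, hD, (aas_abs_numDegree_sub_two_pow_div_le hβ₀ hβ₁ h.1 h.2 D one_pos).mono
      fun n G hG => ?_⟩
    calc (numDegree G D : ℝ) ≤ 2 / (Real.exp 1 * D.factorial) * 2 ^ n := by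
          rw [div_mul_eq_mul_div, mul_div_assoc]
          linarith [(abs_le.1 hG).2]
      _ < c * (D : ℝ) ^ (-T) * 2 ^ n := by gcongr
  · have : (0 : ℝ) < d₀ := Nat.cast_pos.2 hd₀
    exact ⟨d₀, le_rfl, aas_numDegree_lt
      (isLittleO_expNumDegree_of_ne_zero hβ₀ h (Nat.one_le_iff_ne_zero.1 hd₀)) (by positivity)⟩

theorem exists_aas_not_isPowerLaw (hβ₀ : 0 < β) (hβ₁ : β < 1) {c₀ ε : ℝ} (hc₀ : 0 < c₀) (T : ℝ)
    (hε : ε < 1) {d₀ : ℕ} (hd₀ : 1 ≤ d₀) :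
    ∃ D : ℕ, d₀ ≤ D ∧ AAS α β γ fun _ G =>
      ¬∃ c τ : ℝ, c₀ ≤ c ∧ τ ≤ T ∧ IsPowerLaw G c τ ε d₀ D := by
  obtain ⟨D, hD, hlt⟩ := exists_aas_numDegree_lt (α := α) (γ := γ) hβ₀ hβ₁
    (mul_pos (sub_pos.2 hε) hc₀) T hd₀
  refine ⟨D, hD, hlt.mono fun n G hG ⟨c, τ, hc, hτ, hpower⟩ => ?_⟩
  exact not_isPowerLaw_of_numDegree_lt hc₀.le hε.le (hd₀.trans hD) hD hc hτ (by simpa using hG)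
    hpower

theorem isTheta_expNumDegree_or_isLittleO (hβ₀ : 0 < β) (hβ₁ : β < 1) (d : ℕ) :
    (expNumDegree α β γ d =Θ[atTop]
        fun n : ℕ => (((α : ℝ) + (β : ℝ)) ^ d + ((β : ℝ) + (γ : ℝ)) ^ d) ^ n) ∨
      (expNumDegree α β γ d =o[atTop] fun n : ℕ => (2 : ℝ) ^ n) := by
  obtain rfl | hd := eq_or_ne d 0
  · refine (le_or_gt (((α : ℝ) + β) * ((β : ℝ) + γ)) 1).imp (fun h => ?_) fun h =>
      isLittleO_expNumDegree_of_one_lt_mul hβ₀ h 0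
    simpa [one_add_one_eq_two] using isTheta_expNumDegree_zero hβ₀ hβ₁ h
  · by_cases h : (α : ℝ) + β = 1 ∧ (β : ℝ) + γ = 1
    · left
      simpa [h.1, h.2, one_add_one_eq_two] using isTheta_expNumDegree hβ₀ hβ₁ h.1 h.2 d
    · exact .inr (isLittleO_expNumDegree_of_ne_zero hβ₀ h hd)

theorem isTheta_expNumDegree_iff (hβ₀ : 0 < β) (hβ₁ : β < 1) {d : ℕ} (hd : d ≠ 0) :
    (expNumDegree α β γ d =Θ[atTop] fun n : ℕ => (2 : ℝ) ^ n) ↔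
      ((α : ℝ) + (β : ℝ) = 1 ∧ (β : ℝ) + (γ : ℝ) = 1) := by
  refine ⟨fun hΘ => of_not_not fun h => ?_, fun h => isTheta_expNumDegree hβ₀ hβ₁ h.1 h.2 d⟩
  exact isLittleO_irrefl (Eventually.of_forall fun n => by positivity).frequently
    (hΘ.symm.trans_isLittleO (isLittleO_expNumDegree_of_ne_zero hβ₀ h hd))

end

end Kronecker

theorem theorem1_general (α β γ : unitInterval) (hβ₀ : 0 < β) (hβ₁ : β < 1) :
    (∀ (c₀ T ε : ℝ) (d₀ : ℕ), 0 < c₀ → ε < 1 → 1 ≤ d₀ →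
      ∃ D : ℕ, d₀ ≤ D ∧
        Kronecker.AAS α β γ fun _ G =>
          ¬ ∃ c τ : ℝ, c₀ ≤ c ∧ τ ≤ T ∧ Kronecker.IsPowerLaw G c τ ε d₀ D) ∧
    (∀ d : ℕ,
      (Kronecker.expNumDegree α β γ d =Θ[atTop]
        fun n : ℕ => (((α : ℝ) + (β : ℝ)) ^ d + ((β : ℝ) + (γ : ℝ)) ^ d) ^ n) ∨
      (Kronecker.expNumDegree α β γ d =o[atTop] fun n : ℕ => (2 : ℝ) ^ n)) ∧
    (∀ d : ℕ, 1 ≤ d →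
      ((Kronecker.expNumDegree α β γ d =Θ[atTop] fun n : ℕ => (2 : ℝ) ^ n) ↔
        ((α : ℝ) + (β : ℝ) = 1 ∧ (β : ℝ) + (γ : ℝ) = 1))) ∧
    ((α : ℝ) + (β : ℝ) = 1 → (β : ℝ) + (γ : ℝ) = 1 → ∀ d : ℕ,
      (Kronecker.expNumDegree α β γ d ~[atTop]
        fun n : ℕ => (2 : ℝ) ^ n / (Real.exp 1 * (d.factorial : ℝ))) ∧
      ∀ ε : ℝ, 0 < ε → Kronecker.AAS α β γ fun n G =>
        |(Kronecker.numDegree G d : ℝ) - (2 : ℝ) ^ n / (Real.exp 1 * (d.factorial : ℝ))| ≤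
          ε * ((2 : ℝ) ^ n / (Real.exp 1 * (d.factorial : ℝ)))) :=
  ⟨fun _ T _ _ hc₀ hε hd₀ => Kronecker.exists_aas_not_isPowerLaw hβ₀ hβ₁ hc₀ T hε hd₀,
    Kronecker.isTheta_expNumDegree_or_isLittleO hβ₀ hβ₁,
    fun _ hd => Kronecker.isTheta_expNumDegree_iff hβ₀ hβ₁ (Nat.one_le_iff_ne_zero.1 hd),
    fun h₁ h₀ d => ⟨Kronecker.isEquivalent_expNumDegree hβ₀ hβ₁ h₁ h₀ d,
      fun _ => Kronecker.aas_abs_numDegree_sub_two_pow_div_le hβ₀ hβ₁ h₁ h₀ d⟩⟩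

theorem theorem1 (α β γ : unitInterval) (hα₀ : 0 < α) (hα₁ : α < 1) (hβ₀ : 0 < β) (hβ₁ : β < 1)
    (hγ₀ : 0 < γ) (hγ₁ : γ < 1) :
    -- a.a.s. there is no power law in the degrees `d₀, …, D`, for a suitable constant cutoff `D`
    (∀ (c₀ T ε : ℝ) (d₀ : ℕ), 0 < c₀ → 0 < T → 0 < ε → ε < 1 → 1 ≤ d₀ →
      ∃ D : ℕ, d₀ ≤ D ∧
        Kronecker.AAS α β γ fun _ G =>
          ¬ ∃ c τ : ℝ, c₀ ≤ c ∧ 0 < τ ∧ τ ≤ T ∧ Kronecker.IsPowerLaw G c τ ε d₀ D) ∧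
    -- the dichotomy for the expected number of vertices of degree `d`
    (∀ d : ℕ,
      (Kronecker.expNumDegree α β γ d =Θ[atTop]
        fun n : ℕ => (((α : ℝ) + (β : ℝ)) ^ d + ((β : ℝ) + (γ : ℝ)) ^ d) ^ n) ∨
      (Kronecker.expNumDegree α β γ d =o[atTop] fun n : ℕ => (2 : ℝ) ^ n)) ∧
    -- it is linear in the number of vertices in one case only
    (∀ d : ℕ, 1 ≤ d →
      ((Kronecker.expNumDegree α β γ d =Θ[atTop] fun n : ℕ => (2 : ℝ) ^ n) ↔
        ((α : ℝ) + (β : ℝ) = 1 ∧ (β : ℝ) + (γ : ℝ) = 1))) ∧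
    -- in that case the degrees have a Poisson profile with parameter one
    ((α : ℝ) + (β : ℝ) = 1 → (β : ℝ) + (γ : ℝ) = 1 → ∀ d : ℕ,
      (Kronecker.expNumDegree α β γ d ~[atTop]
        fun n : ℕ => (2 : ℝ) ^ n / (Real.exp 1 * (d.factorial : ℝ))) ∧
      ∀ ε : ℝ, 0 < ε → Kronecker.AAS α β γ fun n G =>
        |(Kronecker.numDegree G d : ℝ) - (2 : ℝ) ^ n / (Real.exp 1 * (d.factorial : ℝ))| ≤
          ε * ((2 : ℝ) ^ n / (Real.exp 1 * (d.factorial : ℝ)))) := by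
  obtain ⟨hpower, hrest⟩ := theorem1_general α β γ hβ₀ hβ₁
  exact ⟨fun c₀ T ε d₀ hc₀ _ _ hε hd₀ => (hpower c₀ T ε d₀ hc₀ hε hd₀).imp fun _ =>
    And.imp_right (Kronecker.AAS.mono · fun _ _ hn ⟨c, τ, hc, _, hτ, hG⟩ =>
      hn ⟨c, τ, hc, hτ, hG⟩), hrest⟩
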